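/- \textbf{Setting.} Let $m,p\ge 0$, let $\mathcal S_1,\dots,\mathcal S_m$ and $\mathcal A_1,\dots,\mathcal A_p$ be finite non-empty sets, and put $n=m+p$, $\mathcal S=\prod_{i\le m}\mathcal S_i$, $\mathcal A=\prod_{j\le p}\mathcal A_j$. The state-action space is $\mathcal X=\mathcal S\times\mathcal A=\prod_{i=1}^{n}\mathcal X_i$ with $\mathcal X_i=\mathcal S_i$ for $i\le m$ and $\mathcal X_{m+j}=\mathcal A_j$ for $j\le p$ (a normal factored structure). For $I\subset[n]$ let $\mathcal X[I]=\prod_{i\in I}\mathcal X_i$ and $X[I]=|\mathcal X[I]|$. Let scopes $Z_1,\dots,Z_m\subset[n]$ be given. A factored MDP (FMDP) with this structure consists of component transitions $P_i(\cdot\mid x[Z_i])\in\Delta(\mathcal S_i)$, with $P(s'\mid x)=\prod_{i=1}^m P_i(s'[i]\mid x[Z_i])$, and a reward function $R:\mathcal X\to[0,1]$ (not necessarily factored). Episodes have $H$ steps, and $T=KH$. State component $i$ influences state component $j$ if $i\in Z_j$. Let $\mathcal I$ be the set of those $i\in[m]$ that influence themselves, directly or through a chain of state components, and whose scope $Z_i$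 contains the index of at least one action component. An algorithm with known rewards chooses, for each episode $k$, a (possibly stochastic, step-dependent) policy $\pi_k$ on the basis of the structure, $H$, $K$, the reward function $R$, the trajectories of the earlier episodes, the initial state $s_{k,1}$ of the current episode and internal randomness, but without access to the transitions $P_i$. Its regret is $\mathrm{Regret}(K)=\sum_{k=1}^K\bigl(V_1^*(s_{k,1})-V_1^{\pi_k}(s_{k,1})\bigr)$, where $V_1^\pi(s)$ is the expected total reward of an episode that starts in $s$ and follows $\pi$, and $V_1^*=\sup_\pi V_1^\pi$. \textbf{Theorem 5.} There is a universal constant $c>0$ such that the following holds. Consider any normal factored structure as above with $|\mathcal S_i|\ge 3$ for all $i\in[m]$, in which the scope of every $i\in\mathcal I$ contains an action component with at least two elements, any $H\ge2$, and any number $K$ of episodes with $K\ge X[Z_i]$ for all $i\in\mathcal I$. Then for any algorithm with known rewards there are an FMDP with this structure and initial states $s_{1,1},\dots,s_{K,1}$ such that $$\mathbb E[\mathrm{Regret}(K)]\ \ge\ c\,\max_{i\in\mathcal I}\sqrt{H\,X[Z_i]\,T}$$ (the claim about the regret being void if $\mathcal I=\emptyset$). -/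

import Mathlib

open MeasureTheory

universe u v

noncomputable section

namespace EpisodicRL

/-! ### Episodic tabular decision processes with horizon `H` -/

section Episodic

/-- A stochastic policy: for every step and every state, a probability vector on the actions. -/
abbrev Policy (𝓢 𝓐 : Type u) [Fintype 𝓐] (H : ℕ) : Type u :=
  Fin H → 𝓢 → stdSimplex ℝ 𝓐

/-- The trajectory `s₁, a₁, s₂, a₂, …, s_H, a_H, s_{H+1}` of one episode: the `H + 1` states
and the `H` actions (steps are numbered from `0`). -/
abbrev Trajectory (𝓢 𝓐 : Type u) (H : ℕ) : Type u :=
  (Fin (H + 1) → 𝓢) × (Fin H → 𝓐)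

variable {𝓢 𝓐 : Type u} [Fintype 𝓢] [Fintype 𝓐] {H : ℕ}

open Classical in
/-- The probability of the trajectory `τ` when the episode starts in `s` and `π` is followed in
the process with (stationary) transition function `P`. -/
def trajProb (P : 𝓢 → 𝓐 → stdSimplex ℝ 𝓢) (π : Policy 𝓢 𝓐 H) (s : 𝓢)
    (τ : Trajectory 𝓢 𝓐 H) : ℝ :=
  (if τ.1 0 = s then 1 else 0) *
    ∏ h : Fin H, ((π h (τ.1 h.castSucc)).1 (τ.2 h) *
      (P (τ.1 h.castSucc) (τ.2 h)).1 (τ.1 h.succ))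

/-- The value `V₁^π(s)`: the expected total reward of an episode that starts in `s`. -/
def value (P : 𝓢 → 𝓐 → stdSimplex ℝ 𝓢) (R : 𝓢 → 𝓐 → ℝ) (π : Policy 𝓢 𝓐 H) (s : 𝓢) : ℝ :=
  ∑ τ : Trajectory 𝓢 𝓐 H, trajProb P π s τ * ∑ h : Fin H, R (τ.1 h.castSucc) (τ.2 h)

variable (H) in
/-- The optimal value `V₁^*(s)`, the best value that any policy achieves from `s`. -/
def optValue (P : 𝓢 → 𝓐 → stdSimplex ℝ 𝓢) (R : 𝓢 → 𝓐 → ℝ) (s : 𝓢) : ℝ :=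
  ⨆ π : Policy 𝓢 𝓐 H, value P R π s

end Episodic

/-! ### Learning algorithms and regret -/

/-- A learning algorithm for `K` episodes with known rewards. The policy of episode `k` may
depend on the reward function, on the trajectories of the earlier episodes, on the initial state
of the current episode, and on a random seed `ω : Ω`; it does not see the transition function. -/
structure Algorithm (Ω : Type v) [MeasurableSpace Ω] (𝓢 𝓐 : Type u) [Fintype 𝓐]
    (H K : ℕ) where
  policy : (R : 𝓢 → 𝓐 → ℝ) → (k : Fin K) → (past : Fin k → Trajectory 𝓢 𝓐 H) →
    (s : 𝓢) → Ω → Policy 𝓢 𝓐 H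
  measurable_policy : ∀ R k past s, Measurable (policy R k past s)

section Regret

variable {Ω : Type v} [MeasurableSpace Ω] {𝓢 𝓐 : Type u} [Fintype 𝓢] [Fintype 𝓐] {H K : ℕ}

/-- The policy `π_k` that is played in episode `k` when the seed is `ω`, the initial states are
`s₁` and the trajectories of the episodes are `τ` (only those before `k` matter). -/
def Algorithm.played (alg : Algorithm Ω 𝓢 𝓐 H K) (R : 𝓢 → 𝓐 → ℝ) (s₁ : Fin K → 𝓢)
    (ω : Ω) (τ : Fin K → Trajectory 𝓢 𝓐 H) (k : Fin K) : Policy 𝓢 𝓐 H :=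
  alg.policy R k (fun j : Fin k => τ (j.castLE k.isLt.le)) (s₁ k) ω

/-- `Regret(K) = ∑ₖ (V₁^*(s_{k,1}) - V₁^{π_k}(s_{k,1}))`, as a function of the seed and the
trajectories. -/
def regret (P : 𝓢 → 𝓐 → stdSimplex ℝ 𝓢) (R : 𝓢 → 𝓐 → ℝ) (s₁ : Fin K → 𝓢)
    (alg : Algorithm Ω 𝓢 𝓐 H K) (ω : Ω) (τ : Fin K → Trajectory 𝓢 𝓐 H) : ℝ :=
  ∑ k : Fin K, (optValue H P R (s₁ k) - value P R (alg.played R s₁ ω τ k) (s₁ k))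

/-- The expectation of the regret over the seed, which has law `μ`, and over the trajectories
that the interaction produces. -/
def expectedRegret (P : 𝓢 → 𝓐 → stdSimplex ℝ 𝓢) (R : 𝓢 → 𝓐 → ℝ) (s₁ : Fin K → 𝓢)
    (μ : Measure Ω) (alg : Algorithm Ω 𝓢 𝓐 H K) : ℝ :=
  ∫ ω, ∑ τ : Fin K → Trajectory 𝓢 𝓐 H,
    (∏ k : Fin K, trajProb P (alg.played R s₁ ω τ k) (s₁ k) (τ k)) *
      regret P R s₁ alg ω τ ∂μ

end Regret

/-! ### Normal factored structures -/

section Factored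

variable {m p : ℕ}

/-- The components of the state-action space: those of the state (indices `Sum.inl i`), followed
by those of the action (indices `Sum.inr j`). -/
abbrev Component (S : Fin m → Type u) (A : Fin p → Type u) : Fin m ⊕ Fin p → Type u
  | Sum.inl i => S i
  | Sum.inr j => A j

/-- The state-action pair `x = (s, a)` as a tuple of components. -/
def pair {S : Fin m → Type u} {A : Fin p → Type u} (s : ∀ i, S i) (a : ∀ j, A j) :
    (j : Fin m ⊕ Fin p) → Component S A j
  | Sum.inl i => s i
  | Sum.inr j => a j

/-- The scope space `𝓧[I] = ∏_{j ∈ I} 𝓧_j`. -/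
abbrev ScopeSpace (S : Fin m → Type u) (A : Fin p → Type u) (I : Finset (Fin m ⊕ Fin p)) :
    Type u :=
  (j : {j // j ∈ I}) → Component S A j.1

/-- The cardinality `X[I]` of the scope space. -/
def scopeCard (S : Fin m → Type u) (A : Fin p → Type u) (I : Finset (Fin m ⊕ Fin p)) : ℕ :=
  Nat.card (ScopeSpace S A I)

/-- State component `i` influences state component `j`: `i` lies in the scope of `j`. -/
def Influences (Z : Fin m → Finset (Fin m ⊕ Fin p)) (i j : Fin m) : Prop :=
  Sum.inl i ∈ Z j

/-- State component `i` influences itself, directly or through other state components. -/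
def HasLoop (Z : Fin m → Finset (Fin m ⊕ Fin p)) (i : Fin m) : Prop :=
  Relation.TransGen (Influences Z) i i

/-- The state components that have the loop property and an action component in their scope. -/
def loopActionSet (Z : Fin m → Finset (Fin m ⊕ Fin p)) : Set (Fin m) :=
  {i | HasLoop Z i ∧ ∃ j : Fin p, Sum.inr j ∈ Z i}

/-- A factored decision process with state components `S`, action components `A` and transition
scopes `Z`: the law of the `i`th component of the next state is a function of `x[Z i]`. The
reward is `[0, 1]`-valued and need not be factored. -/
structure FMDP (S : Fin m → Type u) (A : Fin p → Type u) [∀ i, Fintype (S i)]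
    (Z : Fin m → Finset (Fin m ⊕ Fin p)) where
  P : (i : Fin m) → ScopeSpace S A (Z i) → stdSimplex ℝ (S i)
  R : (∀ i, S i) → (∀ j, A j) → ℝ
  R_mem : ∀ s a, R s a ∈ Set.Icc (0 : ℝ) 1

/-- The transition function `P(s' | s, a) = ∏ᵢ Pᵢ(s'[i] | x[Z i])`. -/
def FMDP.transition {S : Fin m → Type u} {A : Fin p → Type u} [∀ i, Fintype (S i)]
    {Z : Fin m → Finset (Fin m ⊕ Fin p)} (M : FMDP S A Z) (s : ∀ i, S i) (a : ∀ j, A j) :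
    stdSimplex ℝ (∀ i, S i) :=
  ⟨fun s' => ∏ i, (M.P i fun j => pair s a j.1).1 (s' i), by
    refine ⟨fun s' => Finset.prod_nonneg fun i _ => (M.P i _).2.1 _, ?_⟩
    rw [← Fintype.prod_sum]
    exact Finset.prod_eq_one fun i _ => (M.P i _).2.2⟩

end Factored

end EpisodicRL

end

/-! The maximum over components only needs the component `i` with the largest scope. Around it one
builds instances in which every episode is one round of a contextual bandit whose outcome is paid `H
- 1` times. The context is the state part of the scope of `i`, the arm its action part. The first
transition flips a coin, fair except for a bias `gap` when the arm is the hidden good arm of the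
context. The result is stored as an on/off value, and the loop through `i` keeps it alive until the
episode ends. The reward, common to all instances and hence uninformative, is 1 while some component
of the loop is on.

Storage must not be confused with the context. This is the role of the third value: an on or off
value at one component of the loop in the scope of `i`, the gate, tells `i` to copy, and any other
value tells it to flip the coin. Discarding two gate values leaves at least a third of the scope
values (`Relay.scopeCard_le`).

The bandit bound is a change of measure (`HardFamily.sum_law_update_mul_pulls_le`). Turning "no good
arm in context `z`" into "`b` is good in `z`" costs relative entropy at most `8 * gap ^ 2` times the
expected number of pulls of `b`. If `gap ^ 2` times the number of visits is small compared with the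
number of arms, most arms are pulled too rarely to be recognised, and averaged over `b` at least a
quarter of the rounds miss the good arm. With `M` contexts, `N` arms and `gap` of order `√(M * N /
K)`, the regret `(H - 1) * gap * K / 4` has order `H * √(M * N * K)`, as required. The seed is fixed
first; averaging over all assignments of good arms then yields one bad assignment. -/

noncomputable section

namespace EpisodicRL

/-! ### Likelihood ratios on a finite space -/

/-- The `L¹` distance of a law `p` and the law with density `L` is controlled by the relative
entropy of `p` with respect to the latter. -/
theorem sum_mul_abs_sub_one_le {ι : Type*} [Fintype ι] {p L : ι → ℝ} (hp : ∀ x, 0 ≤ p x)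
    (hp1 : ∑ x, p x = 1) (hL : ∀ x, 0 < L x) (hL1 : ∑ x, p x * L x = 1) :
    ∑ x, p x * |L x - 1| ≤ 2 * √(∑ x, p x * -Real.log (L x)) := by
  -- Hellinger argument: `|L - 1| = |√L - 1| * (√L + 1)`. With `ρ = ∑ p √L`, Cauchy–Schwarz bounds
  -- the squared distance by `(2 - 2ρ) * (2 + 2ρ)`, where `ρ ≤ 1`.
  have hcs := Finset.sum_mul_sq_le_sq_mul_sq Finset.univ
    (fun x => √(p x) * |√(L x) - 1|) (fun x => √(p x) * (√(L x) + 1))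
  have h1 : ∀ x, √(p x) * |√(L x) - 1| * (√(p x) * (√(L x) + 1)) = p x * |L x - 1| := by
    intro x
    have e : L x - 1 = (√(L x) - 1) * (√(L x) + 1) := by
      nlinarith [Real.sq_sqrt (hL x).le]
    rw [e, abs_mul, abs_of_nonneg (by positivity : 0 ≤ √(L x) + 1)]
    linear_combination |√(L x) - 1| * (√(L x) + 1) * Real.mul_self_sqrt (hp x)
  have h2 : ∀ x, (√(p x) * |√(L x) - 1|) ^ 2 = p x + p x * L x - 2 * (p x * √(L x)) := by
    intro x
    rw [mul_pow, sq_abs, Real.sq_sqrt (hp x)]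
    linear_combination p x * Real.sq_sqrt (hL x).le
  have h3 : ∀ x, (√(p x) * (√(L x) + 1)) ^ 2 = p x + p x * L x + 2 * (p x * √(L x)) := by
    intro x
    rw [mul_pow, Real.sq_sqrt (hp x)]
    linear_combination p x * Real.sq_sqrt (hL x).le
  -- The squared Hellinger distance is at most the relative entropy, because `log √L ≤ √L - 1`.
  have h4 : 2 - 2 * ∑ x, p x * √(L x) ≤ ∑ x, p x * -Real.log (L x) := by
    have : ∑ x, (2 * p x - 2 * (p x * √(L x))) ≤ ∑ x, p x * -Real.log (L x) := by
      refine Finset.sum_le_sum fun x _ => ?_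
      have := Real.log_le_sub_one_of_pos (Real.sqrt_pos.2 (hL x))
      rw [Real.log_sqrt (hL x).le] at this
      nlinarith [hp x]
    rwa [Finset.sum_sub_distrib, ← Finset.mul_sum, ← Finset.mul_sum, hp1, mul_one] at this
  have h0 : 0 ≤ ∑ x, p x * √(L x) := Finset.sum_nonneg fun x _ => mul_nonneg (hp x) (by positivity)
  simp only [h1, h2, h3, Finset.sum_add_distrib, Finset.sum_sub_distrib, ← Finset.mul_sum, hp1,
    hL1] at hcs
  have h5 : (∑ x, p x * √(L x)) ≤ 1 := by
    have : ∑ x, (2 * (p x * √(L x))) ≤ ∑ x, (p x + p x * L x) := by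
      refine Finset.sum_le_sum fun x _ => ?_
      nlinarith [hp x, mul_nonneg (hp x) (sq_nonneg (√(L x) - 1)), Real.sq_sqrt (hL x).le]
    rw [Finset.sum_add_distrib, ← Finset.mul_sum, hp1, hL1] at this
    linarith
  refine le_trans (Real.le_sqrt_of_sq_le hcs) ?_
  rw [Real.sqrt_le_left (by positivity), mul_pow, Real.sq_sqrt (by linarith)]
  nlinarith

/-! ### Products of causal kernels -/

section Causal

variable {T : Type*}

/-- The outcomes before round `k`. -/
def pastOf {K : ℕ} (τ : Fin K → T) (k : Fin K) : Fin k → T :=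
  fun j => τ (j.castLE k.isLt.le)

/-- The probability of the sequence of outcomes `τ` when round `k` has the law `w k past`. -/
def pathProb {K : ℕ} (w : (k : Fin K) → (Fin k → T) → T → ℝ) (τ : Fin K → T) : ℝ :=
  ∏ k, w k (pastOf τ k) (τ k)

theorem pastOf_snoc_castSucc {K : ℕ} (τ : Fin K → T) (t : T) (k : Fin K) :
    pastOf (Fin.snoc τ t : Fin (K + 1) → T) k.castSucc = pastOf τ k := by
  funext j
  exact Fin.snoc_castSucc (α := fun _ => T) t τ (j.castLE k.isLt.le)

theorem pastOf_snoc_last {K : ℕ} (τ : Fin K → T) (t : T) :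
    pastOf (Fin.snoc τ t : Fin (K + 1) → T) (Fin.last K) = τ := by
  funext j
  exact Fin.snoc_castSucc (α := fun _ => T) t τ j

theorem pathProb_snoc {K : ℕ} (w : (k : Fin (K + 1)) → (Fin k → T) → T → ℝ) (τ : Fin K → T)
    (t : T) : pathProb w (Fin.snoc τ t : Fin (K + 1) → T) =
      pathProb (fun k : Fin K => w k.castSucc) τ * w (Fin.last K) τ t := by
  unfold pathProb
  rw [Fin.prod_univ_castSucc]
  congr 1
  · refine Finset.prod_congr rfl fun k _ => ?_
    rw [pastOf_snoc_castSucc, Fin.snoc_castSucc (α := fun _ => T)]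
  · rw [pastOf_snoc_last, Fin.snoc_last (α := fun _ => T)]

theorem sum_snoc [Fintype T] {K : ℕ} (f : (Fin (K + 1) → T) → ℝ) :
    ∑ τ, f τ = ∑ τ : Fin K → T, ∑ t, f (Fin.snoc τ t : Fin (K + 1) → T) := by
  rw [← (Fin.snocEquiv fun _ : Fin (K + 1) => T).sum_comp, Fintype.sum_prod_type,
    Finset.sum_comm]
  rfl

theorem pathProb_nonneg {K : ℕ} {w : (k : Fin K) → (Fin k → T) → T → ℝ}
    (hw : ∀ k past t, 0 ≤ w k past t) (τ : Fin K → T) : 0 ≤ pathProb w τ :=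
  Finset.prod_nonneg fun _ _ => hw _ _ _

theorem sum_pathProb [Fintype T] {K : ℕ} {w : (k : Fin K) → (Fin k → T) → T → ℝ}
    (hw : ∀ k past, ∑ t, w k past t = 1) : ∑ τ, pathProb w τ = 1 := by
  induction K with
  | zero => simp [pathProb]
  | succ K ih =>
    simp only [sum_snoc, pathProb_snoc, ← Finset.mul_sum, hw, mul_one]
    exact ih fun k => hw k.castSucc

/-- The outcome of round `k` has the law `w k past` given the past. -/
theorem sum_pathProb_mul [Fintype T] {K : ℕ} {w : (k : Fin K) → (Fin k → T) → T → ℝ}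
    (hw : ∀ k past, ∑ t, w k past t = 1) (k : Fin K) (f : T → ℝ) :
    ∑ τ, pathProb w τ * f (τ k) =
      ∑ τ, pathProb w τ * ∑ t, w k (pastOf τ k) t * f t := by
  induction K with
  | zero => exact k.elim0
  | succ K ih =>
    simp only [sum_snoc, pathProb_snoc]
    induction k using Fin.lastCases with
    | last =>
      simp only [pastOf_snoc_last, Fin.snoc_last (α := fun _ => T), ← Finset.sum_mul,
        ← Finset.mul_sum, hw, one_mul, mul_assoc]
    | cast k =>
      simp only [pastOf_snoc_castSucc, Fin.snoc_castSucc (α := fun _ => T), ← Finset.sum_mul,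
        ← Finset.mul_sum, hw, mul_one]
      exact ih (fun k => hw k.castSucc) k

end Causal

/-! ### The law of one episode -/

section Episode

variable {𝓢 𝓐 : Type u} [Fintype 𝓢] [Fintype 𝓐] {H : ℕ}

theorem trajProb_nonneg (P : 𝓢 → 𝓐 → stdSimplex ℝ 𝓢) (π : Policy 𝓢 𝓐 H) (s : 𝓢)
    (τ : Trajectory 𝓢 𝓐 H) : 0 ≤ trajProb P π s τ := by
  unfold trajProb
  refine mul_nonneg (by split_ifs <;> norm_num) (Finset.prod_nonneg fun h _ => ?_)
  exact mul_nonneg ((π h _).2.1 _) ((P _ _).2.1 _)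

/-- Inductions on the horizon remove the last step rather than the first: the initial state stays
the same, and the removed factors sum to 1. -/
theorem trajProb_snoc (P : 𝓢 → 𝓐 → stdSimplex ℝ 𝓢) (π : Policy 𝓢 𝓐 (H + 1)) (s : 𝓢)
    (σ : Fin (H + 1) → 𝓢) (α : Fin H → 𝓐) (s' : 𝓢) (a : 𝓐) :
    trajProb P π s ((Fin.snoc σ s' : Fin (H + 1 + 1) → 𝓢), (Fin.snoc α a : Fin (H + 1) → 𝓐)) =
      trajProb P (fun h => π h.castSucc) s (σ, α) *
        ((π (Fin.last H) (σ (Fin.last H))).1 a * (P (σ (Fin.last H)) a).1 s') := by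
  unfold trajProb
  rw [Fin.prod_univ_castSucc, ← mul_assoc]
  have h0 : (Fin.snoc σ s' : Fin (H + 1 + 1) → 𝓢) 0 = σ 0 :=
    Fin.snoc_castSucc (α := fun _ => 𝓢) s' σ 0
  have hc : ∀ h : Fin (H + 1), (Fin.snoc σ s' : Fin (H + 1 + 1) → 𝓢) h.castSucc = σ h :=
    fun h => Fin.snoc_castSucc (α := fun _ => 𝓢) s' σ h
  have hs : ∀ h : Fin H, (Fin.snoc σ s' : Fin (H + 1 + 1) → 𝓢) h.castSucc.succ = σ h.succ :=
    fun h => Fin.snoc_castSucc (α := fun _ => 𝓢) s' σ h.succ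
  have hl : (Fin.snoc σ s' : Fin (H + 1 + 1) → 𝓢) (Fin.last H).succ = s' :=
    Fin.snoc_last (α := fun _ => 𝓢) s' σ
  have ha : ∀ h : Fin H, (Fin.snoc α a : Fin (H + 1) → 𝓐) h.castSucc = α h :=
    fun h => Fin.snoc_castSucc (α := fun _ => 𝓐) a α h
  have hal : (Fin.snoc α a : Fin (H + 1) → 𝓐) (Fin.last H) = a :=
    Fin.snoc_last (α := fun _ => 𝓐) a α
  simp only [hc, hs, hl, ha, hal]
  congr 2

theorem sum_trajectory_succ (f : Trajectory 𝓢 𝓐 (H + 1) → ℝ) :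
    ∑ τ, f τ = ∑ τ : Trajectory 𝓢 𝓐 H, ∑ a, ∑ s',
      f ((Fin.snoc τ.1 s' : Fin (H + 1 + 1) → 𝓢), (Fin.snoc τ.2 a : Fin (H + 1) → 𝓐)) := by
  rw [Fintype.sum_prod_type, Fintype.sum_prod_type, sum_snoc]
  refine Finset.sum_congr rfl fun σ _ => ?_
  simp only [sum_snoc]
  rw [Finset.sum_comm]
  refine Finset.sum_congr rfl fun α _ => ?_
  rw [Finset.sum_comm]

theorem sum_last_step (P : 𝓢 → 𝓐 → stdSimplex ℝ 𝓢) (d : stdSimplex ℝ 𝓐) (s : 𝓢) :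
    ∑ a, ∑ s', d.1 a * (P s a).1 s' = 1 := by
  simp only [← Finset.mul_sum, (P _ _).2.2, mul_one, d.2.2]

theorem sum_trajectory_zero (f : Trajectory 𝓢 𝓐 0 → ℝ) :
    ∑ τ, f τ = ∑ s, f (fun _ => s, Fin.elim0) := by
  rw [Fintype.sum_prod_type, ← (Equiv.funUnique (Fin 1) 𝓢).symm.sum_comp]
  refine Finset.sum_congr rfl fun s _ => ?_
  rw [Fintype.sum_unique]
  congr 2

/-- The law of the first action and of the second state of an episode. -/
theorem sum_trajProb_mul (P : 𝓢 → 𝓐 → stdSimplex ℝ 𝓢) (π : Policy 𝓢 𝓐 (H + 1)) (s : 𝓢)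
    (g : 𝓐 → 𝓢 → ℝ) :
    ∑ τ, trajProb P π s τ * g (τ.2 0) (τ.1 1) =
      ∑ a, (π 0 s).1 a * ∑ s', (P s a).1 s' * g a s' := by
  induction H with
  | zero =>
    rw [sum_trajectory_succ, sum_trajectory_zero]
    simp only [trajProb_snoc]
    have h1 : ∀ (σ : Fin 1 → 𝓢) s', (Fin.snoc σ s' : Fin 2 → 𝓢) 1 = s' :=
      fun σ s' => Fin.snoc_last (α := fun _ => 𝓢) s' σ
    have h2 : ∀ (α : Fin 0 → 𝓐) a, (Fin.snoc α a : Fin 1 → 𝓐) 0 = a :=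
      fun α a => Fin.snoc_last (α := fun _ => 𝓐) a α
    simp only [Nat.reduceAdd, Fin.isValue, h1, h2]
    rw [Finset.sum_eq_single s]
    · simp [trajProb, Finset.mul_sum, mul_assoc]
    · intro b _ hb
      simp [trajProb, hb]
    · simp
  | succ H ih =>
    rw [sum_trajectory_succ]
    refine Eq.trans (Finset.sum_congr rfl fun τ _ => ?_) (ih fun h => π h.castSucc)
    have h1 : ∀ s', (Fin.snoc τ.1 s' : Fin (H + 1 + 1 + 1) → 𝓢) 1 = τ.1 1 :=
      fun s' => Fin.snoc_castSucc (α := fun _ => 𝓢) s' τ.1 1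
    have h2 : ∀ a, (Fin.snoc τ.2 a : Fin (H + 1 + 1) → 𝓐) 0 = τ.2 0 :=
      fun a => Fin.snoc_castSucc (α := fun _ => 𝓐) a τ.2 0
    simp only [trajProb_snoc, h1, h2, ← Finset.sum_mul, ← Finset.mul_sum]
    simp only [Finset.mul_sum, sum_last_step, mul_one]

theorem sum_trajProb (P : 𝓢 → 𝓐 → stdSimplex ℝ 𝓢) (π : Policy 𝓢 𝓐 H) (s : 𝓢) :
    ∑ τ, trajProb P π s τ = 1 := by
  induction H with
  | zero =>
    classical
    rw [sum_trajectory_zero]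
    simp [trajProb]
  | succ H ih =>
    rw [sum_trajectory_succ, ← ih fun h => π h.castSucc]
    refine Finset.sum_congr rfl fun τ _ => ?_
    simp only [trajProb_snoc, ← Finset.mul_sum]
    simp only [Finset.mul_sum, sum_last_step, mul_one]

theorem abs_value_le {P : 𝓢 → 𝓐 → stdSimplex ℝ 𝓢} {R : 𝓢 → 𝓐 → ℝ}
    (hR : ∀ s a, R s a ∈ Set.Icc (0 : ℝ) 1) (π : Policy 𝓢 𝓐 H) (s : 𝓢) :
    |value P R π s| ≤ H := by
  unfold value
  have h0 : ∀ τ : Trajectory 𝓢 𝓐 H, 0 ≤ ∑ h : Fin H, R (τ.1 h.castSucc) (τ.2 h) :=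
    fun τ => Finset.sum_nonneg fun h _ => (hR _ _).1
  rw [abs_of_nonneg (Finset.sum_nonneg fun τ _ => mul_nonneg (trajProb_nonneg P π s τ) (h0 τ)),
    ← one_mul (H : ℝ), ← sum_trajProb P π s, Finset.sum_mul]
  refine Finset.sum_le_sum fun τ _ => mul_le_mul_of_nonneg_left ?_ (trajProb_nonneg P π s τ)
  refine (Finset.sum_le_sum fun h _ => (hR _ _).2).trans ?_
  simp

theorem value_le_optValue {P : 𝓢 → 𝓐 → stdSimplex ℝ 𝓢} {R : 𝓢 → 𝓐 → ℝ}
    (hR : ∀ s a, R s a ∈ Set.Icc (0 : ℝ) 1) (π : Policy 𝓢 𝓐 H) (s : 𝓢) :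
    value P R π s ≤ optValue H P R s :=
  le_ciSup (f := fun π : Policy 𝓢 𝓐 H => value P R π s)
    ⟨H, by rintro _ ⟨π, rfl⟩; exact (le_abs_self _).trans (abs_value_le hR π s)⟩ π

end Episode

/-! ### A family of processes with one hidden good arm per context -/

/-- Processes in which only the first action of an episode matters: in the initial state of the
context `z` it draws a fair coin, biased by `gap` if the arm of the action is `θ z`; the outcome
is remembered for the rest of the episode. -/
structure HardFamily (𝓢 𝓐 C B : Type u) [Fintype 𝓢] [Fintype 𝓐] where
  -- The value `none` stands for a context without a good arm, whose coin is fair for every action.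
  -- It provides the reference law of the change of measure.
  P : (C → Option B) → 𝓢 → 𝓐 → stdSimplex ℝ 𝓢
  gap : ℝ
  init : C → 𝓢
  arm : 𝓐 → B
  settled : 𝓢 → Prop
  good : 𝓢 → Prop
  gap_nonneg : 0 ≤ gap
  gap_le : gap ≤ 1 / 4
  arm_surjective : Function.Surjective arm
  not_good_init : ∀ z, ¬ good (init z)
  settled_init : ∀ θ z a s', (P θ (init z) a).1 s' ≠ 0 → settled s'
  settled_step : ∀ θ s a s', settled s → (P θ s a).1 s' ≠ 0 → settled s' ∧ (good s' ↔ good s)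
  eq_of_settled : ∀ θ θ' s a, settled s → P θ s a = P θ' s a
  apply_of_eq : ∀ θ z a s', θ z = some (arm a) → (P θ (init z) a).1 s' =
    (P (fun _ => none) (init z) a).1 s' * (1 + 2 * gap * open Classical in if good s' then 1 else -1)
  apply_of_ne : ∀ θ z a s', θ z ≠ some (arm a) →
    (P θ (init z) a).1 s' = (P (fun _ => none) (init z) a).1 s'
  balanced : ∀ z a, ∑ s', (P (fun _ => none) (init z) a).1 s' *
    (open Classical in if good s' then 1 else -1) = 0

namespace HardFamily

variable {𝓢 𝓐 C B : Type u} [Fintype 𝓢] [Fintype 𝓐] (F : HardFamily 𝓢 𝓐 C B) {n : ℕ}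

open Classical in
/-- The outcome of the coin as a sign. -/
def sign (s : 𝓢) : ℝ := if F.good s then 1 else -1

open Classical in
/-- The reward is collected while the good outcome is remembered. -/
def reward (s : 𝓢) (_ : 𝓐) : ℝ := if F.good s then 1 else 0

theorem reward_mem (s : 𝓢) (a : 𝓐) : F.reward s a ∈ Set.Icc (0 : ℝ) 1 := by
  unfold reward
  split_ifs <;> simp

theorem reward_congr {s s' : 𝓢} (h : F.good s ↔ F.good s') (a a' : 𝓐) :
    F.reward s a = F.reward s' a' := by
  by_cases hs : F.good s
  · simp [reward, hs, h.1 hs]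
  · simp [reward, hs, mt h.2 hs]

theorem sign_cases (s : 𝓢) : F.sign s = 1 ∨ F.sign s = -1 := by
  unfold sign
  split_ifs <;> simp

theorem reward_eq (s : 𝓢) (a : 𝓐) : F.reward s a = (1 + F.sign s) / 2 := by
  unfold reward sign
  split_ifs <;> norm_num

theorem sum_sign (z : C) (a : 𝓐) : ∑ s', (F.P (fun _ => none) (F.init z) a).1 s' * F.sign s' = 0 :=
  F.balanced z a

/-- A trajectory of positive probability is determined, as far as goodness goes, by its second
state. All later computations may discard the other trajectories. -/
theorem support {θ : C → Option B} {π : Policy 𝓢 𝓐 (n + 1)} {z : C}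
    {τ : Trajectory 𝓢 𝓐 (n + 1)} (hτ : trajProb (F.P θ) π (F.init z) τ ≠ 0) :
    τ.1 0 = F.init z ∧ ∀ h : Fin (n + 1), F.settled (τ.1 h.succ) ∧
      (F.good (τ.1 h.succ) ↔ F.good (τ.1 1)) := by
  unfold trajProb at hτ
  have h0 : τ.1 0 = F.init z := by
    by_contra h
    simp [h] at hτ
  have hP : ∀ h : Fin (n + 1), (F.P θ (τ.1 h.castSucc) (τ.2 h)).1 (τ.1 h.succ) ≠ 0 := fun h =>
    right_ne_zero_of_mul (Finset.prod_ne_zero_iff.1 (right_ne_zero_of_mul hτ) h (Finset.mem_univ _))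
  refine ⟨h0, fun h => ?_⟩
  induction h using Fin.induction with
  | zero =>
    refine ⟨F.settled_init θ z (τ.2 0) _ ?_, Iff.rfl⟩
    have := hP 0
    rwa [Fin.castSucc_zero, h0] at this
  | succ i ih =>
    have := F.settled_step θ _ _ _ ih.1 (hP i.succ)
    exact ⟨this.1, this.2.trans ih.2⟩

open Classical in
/-- The probability that the first action has the arm `b`. -/
def armProb (π : Policy 𝓢 𝓐 (n + 1)) (z : C) (b : B) : ℝ :=
  ∑ a, (π 0 (F.init z)).1 a * if F.arm a = b then 1 else 0

theorem armProb_nonneg (π : Policy 𝓢 𝓐 (n + 1)) (z : C) (b : B) : 0 ≤ F.armProb π z b :=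
  Finset.sum_nonneg fun a _ => mul_nonneg ((π 0 _).2.1 a) (by split_ifs <;> norm_num)

theorem armProb_le_one (π : Policy 𝓢 𝓐 (n + 1)) (z : C) (b : B) : F.armProb π z b ≤ 1 := by
  rw [← (π 0 (F.init z)).2.2]
  refine Finset.sum_le_sum fun a _ => ?_
  have := (π 0 (F.init z)).2.1 a
  split_ifs
  · rw [mul_one]
  · rw [mul_zero]; exact this

theorem sum_armProb [Fintype B] (π : Policy 𝓢 𝓐 (n + 1)) (z : C) :
    ∑ b, F.armProb π z b = 1 := by
  classical
  unfold armProb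
  rw [Finset.sum_comm]
  simp only [← Finset.mul_sum, Finset.sum_ite_eq, Finset.mem_univ, if_true, mul_one]
  exact (π 0 (F.init z)).2.2

/-- For the good arm the density `1 + 2 * gap * sign` times the reward `(1 + sign) / 2` equals `(1 /
2 + gap) * (1 + sign)`, since `sign ^ 2 = 1`; the sign has mean zero under the fair coin. -/
theorem sum_reward_init {θ : C → Option B} {z : C} {b : B} (hb : θ z = some b) (a : 𝓐) :
    ∑ s', (F.P θ (F.init z) a).1 s' * F.reward s' a =
      1 / 2 + F.gap * open Classical in if F.arm a = b then 1 else 0 := by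
  have hs := F.sum_sign z a
  have h1 := (F.P (fun _ => none) (F.init z) a).2.2
  split_ifs with h
  · have : ∀ s', (F.P θ (F.init z) a).1 s' * F.reward s' a =
        (1 / 2 + F.gap) * ((F.P (fun _ => none) (F.init z) a).1 s' +
          (F.P (fun _ => none) (F.init z) a).1 s' * F.sign s') := by
      intro s'
      rw [F.apply_of_eq θ z a s' (by rw [hb, h]), F.reward_eq]
      change _ * (1 + 2 * F.gap * F.sign s') * _ = _
      rcases F.sign_cases s' with e | e <;> rw [e] <;> ring
    simp only [this, ← Finset.mul_sum, Finset.sum_add_distrib, hs, h1]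
    ring
  · have : ∀ s', (F.P θ (F.init z) a).1 s' * F.reward s' a =
        (1 / 2) * ((F.P (fun _ => none) (F.init z) a).1 s' +
          (F.P (fun _ => none) (F.init z) a).1 s' * F.sign s') := by
      intro s'
      rw [F.apply_of_ne θ z a s' (by rw [hb]; simpa using fun e => h e.symm), F.reward_eq]
      ring
    simp only [this, ← Finset.mul_sum, Finset.sum_add_distrib, hs, h1]
    ring

/-- The initial state pays nothing and the remaining `n` steps of the horizon `n + 1` all pay the
outcome of the coin, so only the law of the first action matters. -/
theorem value_eq {θ : C → Option B} {z : C} {b : B} (hb : θ z = some b)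
    (π : Policy 𝓢 𝓐 (n + 1)) :
    value (F.P θ) F.reward π (F.init z) = n * (1 / 2 + F.gap * F.armProb π z b) := by
  have h1 : ∀ τ : Trajectory 𝓢 𝓐 (n + 1), trajProb (F.P θ) π (F.init z) τ *
      ∑ h : Fin (n + 1), F.reward (τ.1 h.castSucc) (τ.2 h) =
      trajProb (F.P θ) π (F.init z) τ * (n * F.reward (τ.1 1) (τ.2 0)) := by
    intro τ
    by_cases hτ : trajProb (F.P θ) π (F.init z) τ = 0
    · rw [hτ, zero_mul, zero_mul]
    obtain ⟨h0, hs⟩ := F.support hτ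
    congr 1
    rw [Fin.sum_univ_succ, Fin.castSucc_zero, h0]
    have e0 : F.reward (F.init z) (τ.2 0) = 0 := if_neg (F.not_good_init z)
    have e1 : ∀ h : Fin n, F.reward (τ.1 h.castSucc.succ) (τ.2 h.succ) =
        F.reward (τ.1 1) (τ.2 0) := by
      intro h
      exact F.reward_congr (hs h.castSucc).2 _ _
    simp [e0, e1]
  unfold value
  simp only [h1]
  rw [sum_trajProb_mul (F.P θ) π (F.init z) fun a s' => n * F.reward s' a]
  have h2 : ∀ a, ∑ s', (F.P θ (F.init z) a).1 s' * (n * F.reward s' a) =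
      n * (1 / 2 + F.gap * open Classical in if F.arm a = b then 1 else 0) := by
    intro a
    rw [← F.sum_reward_init hb a, Finset.mul_sum]
    exact Finset.sum_congr rfl fun s' _ => by ring
  simp only [h2, armProb]
  have h3 := (π 0 (F.init z)).2.2
  have h4 : (1 / 2 : ℝ) = ∑ a, (π 0 (F.init z)).1 a * (1 / 2) := by
    rw [← Finset.sum_mul, h3, one_mul]
  rw [h4, Finset.mul_sum, ← Finset.sum_add_distrib, Finset.mul_sum, ← h4]
  exact Finset.sum_congr rfl fun s' _ => by ring

theorem le_optValue {θ : C → Option B} {z : C} {b : B} (hb : θ z = some b) :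
    n * (1 / 2 + F.gap) ≤ optValue (n + 1) (F.P θ) F.reward (F.init z) := by
  classical
  obtain ⟨a, ha⟩ := F.arm_surjective b
  let π : Policy 𝓢 𝓐 (n + 1) := fun _ _ => ⟨Pi.single a 1, single_mem_stdSimplex ℝ a⟩
  refine le_trans (le_of_eq ?_) (value_le_optValue F.reward_mem π (F.init z))
  rw [F.value_eq hb]
  have : F.armProb π z b = 1 := by
    unfold armProb
    rw [Finset.sum_eq_single a]
    · simp [π, ha]
    · intro a' _ h
      simp [π, h]
    · simp
  rw [this, mul_one]

/-- Reduces regret to a bandit quantity: an episode costs `n * gap` times the probability of missing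
the good arm. -/
theorem le_optValue_sub_value {θ : C → Option B} {z : C} {b : B} (hb : θ z = some b)
    (π : Policy 𝓢 𝓐 (n + 1)) :
    n * F.gap * (1 - F.armProb π z b) ≤
      optValue (n + 1) (F.P θ) F.reward (F.init z) - value (F.P θ) F.reward π (F.init z) := by
  have := F.le_optValue (n := n) hb
  rw [F.value_eq hb]
  linarith

open Classical in
/-- The likelihood ratio of the episode `τ` started in context `z'` after the arm `b` has been
made the good one of context `z`. -/
def ratio (z : C) (b : B) (z' : C) (a : 𝓐) (s : 𝓢) : ℝ :=
  if z' = z ∧ F.arm a = b then 1 + 2 * F.gap * F.sign s else 1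

theorem ratio_pos (z : C) (b : B) (z' : C) (a : 𝓐) (s : 𝓢) : 0 < F.ratio z b z' a s := by
  have h0 := F.gap_nonneg
  have h1 := F.gap_le
  unfold ratio
  split_ifs
  · rcases F.sign_cases s with e | e <;> rw [e] <;> linarith
  · exact one_pos

open Classical in
theorem P_update {θ : C → Option B} {z : C} (hz : θ z = none) (b : B) (z' : C) (a : 𝓐) (s : 𝓢) :
    (F.P (Function.update θ z (some b)) (F.init z') a).1 s =
      (F.P θ (F.init z') a).1 s * F.ratio z b z' a s := by
  unfold ratio
  by_cases hzz : z' = z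
  · subst hzz
    rw [F.apply_of_ne θ z' a s (by simp [hz])]
    by_cases hb : F.arm a = b
    · rw [if_pos ⟨rfl, hb⟩, F.apply_of_eq _ z' a s (by simp [hb])]
      rfl
    · rw [if_neg (fun h => hb h.2), F.apply_of_ne _ z' a s (by simpa using fun h => hb h.symm),
        mul_one]
  · rw [if_neg (fun h => hzz h.1), mul_one]
    have e : Function.update θ z (some b) z' = θ z' := Function.update_of_ne hzz _ _
    by_cases h : θ z' = some (F.arm a)
    · rw [F.apply_of_eq θ z' a s h, F.apply_of_eq _ z' a s (e.trans h)]
    · rw [F.apply_of_ne θ z' a s h, F.apply_of_ne _ z' a s (by rwa [e])]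

-- Of all the factors only the first transition depends on the good arms; the later ones leave
-- settled states, where the transition is common to all instances. Trajectories outside the support
-- have probability zero on both sides.
open Classical in
theorem trajProb_update {θ : C → Option B} {z : C} (hz : θ z = none) (b : B) (z' : C)
    (π : Policy 𝓢 𝓐 (n + 1)) (τ : Trajectory 𝓢 𝓐 (n + 1)) :
    trajProb (F.P (Function.update θ z (some b))) π (F.init z') τ =
      trajProb (F.P θ) π (F.init z') τ * F.ratio z b z' (τ.2 0) (τ.1 1) := by
  by_cases h : trajProb (F.P (Function.update θ z (some b))) π (F.init z') τ = 0 ∧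
      trajProb (F.P θ) π (F.init z') τ = 0
  · rw [h.1, h.2, zero_mul]
  obtain ⟨h0, hs⟩ : τ.1 0 = F.init z' ∧ ∀ h : Fin (n + 1), F.settled (τ.1 h.succ) := by
    rcases not_and_or.1 h with h | h
    · exact ⟨(F.support h).1, fun i => ((F.support h).2 i).1⟩
    · exact ⟨(F.support h).1, fun i => ((F.support h).2 i).1⟩
  unfold trajProb
  rw [Fin.prod_univ_succ, Fin.prod_univ_succ, Fin.castSucc_zero, h0, F.P_update hz]
  have : ∀ i : Fin n, F.P (Function.update θ z (some b)) (τ.1 i.succ.castSucc) (τ.2 i.succ) =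
      F.P θ (τ.1 i.succ.castSucc) (τ.2 i.succ) := fun i => by
    rw [← Fin.succ_castSucc]
    exact F.eq_of_settled _ _ _ _ (hs i.castSucc)
  simp only [this]
  have h1 : τ.1 (Fin.succ 0) = τ.1 1 := rfl
  rw [h1]
  ring

/-- From `log x ≥ 1 - 1 / x`. It is used with `u = ± 2 * gap`, which `gap ≤ 1 / 4` keeps above `-1 /
2`. -/
theorem neg_log_one_add_le {u : ℝ} (hu : -(1 / 2) ≤ u) : -Real.log (1 + u) ≤ -u + 2 * u ^ 2 := by
  have h := Real.one_sub_inv_le_log_of_pos (show 0 < 1 + u by linarith)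
  have : 1 - (1 + u)⁻¹ - (u - 2 * u ^ 2) = u ^ 2 * (1 + 2 * u) / (1 + u) := by
    field_simp [show (1 + u) ≠ 0 by linarith]
    ring
  have h2 : 0 ≤ u ^ 2 * (1 + 2 * u) / (1 + u) :=
    div_nonneg (mul_nonneg (sq_nonneg u) (by linarith)) (by linarith)
  linarith

/-- The relative entropy produced in one episode. -/
theorem sum_trajProb_mul_neg_log_ratio_le {θ : C → Option B} {z : C} (hz : θ z = none) (b : B)
    (z' : C) (π : Policy 𝓢 𝓐 (n + 1)) :
    ∑ τ, trajProb (F.P θ) π (F.init z') τ * -Real.log (F.ratio z b z' (τ.2 0) (τ.1 1)) ≤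
      open Classical in if z' = z then 8 * F.gap ^ 2 * F.armProb π z b else 0 := by
  have h0 := F.gap_nonneg
  have h1 := F.gap_le
  rw [sum_trajProb_mul (F.P θ) π (F.init z') fun a s => -Real.log (F.ratio z b z' a s)]
  split_ifs with h
  · subst h
    unfold armProb
    rw [Finset.mul_sum]
    refine Finset.sum_le_sum fun a _ => ?_
    rw [mul_left_comm]
    refine mul_le_mul_of_nonneg_left ?_ ((π 0 _).2.1 a)
    unfold ratio
    by_cases hb : F.arm a = b
    · simp only [hb, and_self, if_true, mul_one]
      -- The reference coin is fair because `θ z' = none`, so the linear term averages to zero and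
      -- the quadratic term `2 * (2 * gap) ^ 2` remains.
      calc _ ≤ ∑ s', (F.P θ (F.init z') a).1 s' *
            (-(2 * F.gap) * F.sign s' + 8 * F.gap ^ 2) := by
            refine Finset.sum_le_sum fun s' _ => mul_le_mul_of_nonneg_left ?_ ((F.P θ _ _).2.1 _)
            have := neg_log_one_add_le (u := 2 * F.gap * F.sign s')
              (by rcases F.sign_cases s' with e | e <;> rw [e] <;> linarith)
            refine this.trans (le_of_eq ?_)
            rcases F.sign_cases s' with e | e <;> rw [e] <;> ring
        _ = -(2 * F.gap) * ∑ s', (F.P (fun _ => none) (F.init z') a).1 s' * F.sign s' +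
            8 * F.gap ^ 2 * ∑ s', (F.P θ (F.init z') a).1 s' := by
            rw [Finset.mul_sum, Finset.mul_sum, ← Finset.sum_add_distrib]
            refine Finset.sum_congr rfl fun s' _ => ?_
            rw [← F.apply_of_ne θ z' a s' (by simp [hz])]
            ring
        _ = _ := by
            rw [F.sum_sign, (F.P θ _ _).2.2]
            ring
        _ ≤ _ := le_rfl
    · simp [hb]
  · refine le_of_eq (Finset.sum_eq_zero fun a _ => ?_)
    simp [ratio, h]

end HardFamily

/-! ### Change of measure over all episodes and averaging over the good arms -/

namespace HardFamily

variable {𝓢 𝓐 C B : Type u} [Fintype 𝓢] [Fintype 𝓐] (F : HardFamily 𝓢 𝓐 C B) {n K : ℕ}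
  (ctx : Fin K → C)
  (pol : (k : Fin K) → (Fin k → Trajectory 𝓢 𝓐 (n + 1)) → Policy 𝓢 𝓐 (n + 1))

/-- The law of the trajectories of all episodes. -/
def law (θ : C → Option B) (τ : Fin K → Trajectory 𝓢 𝓐 (n + 1)) : ℝ :=
  pathProb (fun k past => trajProb (F.P θ) (pol k past) (F.init (ctx k))) τ

theorem law_nonneg (θ : C → Option B) (τ : Fin K → Trajectory 𝓢 𝓐 (n + 1)) :
    0 ≤ F.law ctx pol θ τ :=
  pathProb_nonneg (fun _ _ _ => trajProb_nonneg _ _ _ _) τ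

theorem sum_law (θ : C → Option B) : ∑ τ, F.law ctx pol θ τ = 1 :=
  sum_pathProb fun _ _ => sum_trajProb _ _ _

open Classical in
/-- The number of episodes with context `z`. -/
def visits (z : C) : ℝ := ∑ k, if ctx k = z then 1 else 0

open Classical in
/-- The expected number of choices of the arm `b` in context `z`. -/
def pulls (z : C) (b : B) (τ : Fin K → Trajectory 𝓢 𝓐 (n + 1)) : ℝ :=
  ∑ k, if ctx k = z then F.armProb (pol k (pastOf τ k)) z b else 0

theorem visits_nonneg (z : C) : 0 ≤ visits ctx z :=
  Finset.sum_nonneg fun k _ => by split_ifs <;> norm_num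

theorem pulls_nonneg (z : C) (b : B) (τ : Fin K → Trajectory 𝓢 𝓐 (n + 1)) :
    0 ≤ F.pulls ctx pol z b τ :=
  Finset.sum_nonneg fun k _ => by
    split_ifs
    · exact F.armProb_nonneg _ _ _
    · exact le_rfl

theorem pulls_le (z : C) (b : B) (τ : Fin K → Trajectory 𝓢 𝓐 (n + 1)) :
    F.pulls ctx pol z b τ ≤ visits ctx z :=
  Finset.sum_le_sum fun k _ => by
    split_ifs
    · exact F.armProb_le_one _ _ _
    · exact le_rfl

theorem sum_pulls [Fintype B] (z : C) (τ : Fin K → Trajectory 𝓢 𝓐 (n + 1)) :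
    ∑ b, F.pulls ctx pol z b τ = visits ctx z := by
  unfold pulls visits
  rw [Finset.sum_comm]
  refine Finset.sum_congr rfl fun k _ => ?_
  split_ifs
  · exact F.sum_armProb _ _
  · exact Finset.sum_const_zero

open Classical in
theorem law_update {θ : C → Option B} {z : C} (hz : θ z = none) (b : B)
    (τ : Fin K → Trajectory 𝓢 𝓐 (n + 1)) :
    F.law ctx pol (Function.update θ z (some b)) τ =
      F.law ctx pol θ τ * ∏ k, F.ratio z b (ctx k) ((τ k).2 0) ((τ k).1 1) := by
  unfold law pathProb
  rw [← Finset.prod_mul_distrib]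
  exact Finset.prod_congr rfl fun k _ => F.trajProb_update hz b (ctx k) _ _

/-- Chain rule for the relative entropy: the logarithm turns the product over episodes into a sum,
and each term is averaged under the law of its episode given the past. -/
theorem sum_law_mul_neg_log_le {θ : C → Option B} {z : C} (hz : θ z = none) (b : B) :
    ∑ τ, F.law ctx pol θ τ * -Real.log (∏ k, F.ratio z b (ctx k) ((τ k).2 0) ((τ k).1 1)) ≤
      8 * F.gap ^ 2 * ∑ τ, F.law ctx pol θ τ * F.pulls ctx pol z b τ := by
  have h1 : ∀ τ : Fin K → Trajectory 𝓢 𝓐 (n + 1), F.law ctx pol θ τ *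
      -Real.log (∏ k, F.ratio z b (ctx k) ((τ k).2 0) ((τ k).1 1)) =
      ∑ k, F.law ctx pol θ τ * -Real.log (F.ratio z b (ctx k) ((τ k).2 0) ((τ k).1 1)) := by
    intro τ
    rw [Real.log_prod fun k _ => (F.ratio_pos _ _ _ _ _).ne', ← Finset.sum_neg_distrib,
      Finset.mul_sum]
  simp only [h1]
  rw [Finset.sum_comm]
  unfold law
  have h2 := fun k => sum_pathProb_mul
    (w := fun k past => trajProb (F.P θ) (pol k past) (F.init (ctx k)))
    (fun _ _ => sum_trajProb _ _ _) k fun t => -Real.log (F.ratio z b (ctx k) (t.2 0) (t.1 1))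
  simp only [h2]
  rw [Finset.sum_comm, Finset.mul_sum]
  refine Finset.sum_le_sum fun τ _ => ?_
  rw [← Finset.mul_sum, mul_left_comm]
  refine mul_le_mul_of_nonneg_left ?_ (F.law_nonneg ctx pol θ τ)
  unfold pulls
  rw [Finset.mul_sum]
  refine Finset.sum_le_sum fun k _ => ?_
  refine (F.sum_trajProb_mul_neg_log_ratio_le hz b (ctx k) _).trans (le_of_eq ?_)
  split_ifs with h
  · rfl
  · rw [mul_zero]

-- The number of pulls lies between 0 and the number of visits, so changing the law raises its mean
-- by at most the visits times the `L¹` distance, which the relative entropy controls.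
open Classical in
theorem sum_law_update_mul_pulls_le {θ : C → Option B} {z : C} (hz : θ z = none) (b : B) :
    ∑ τ, F.law ctx pol (Function.update θ z (some b)) τ * F.pulls ctx pol z b τ ≤
      ∑ τ, F.law ctx pol θ τ * F.pulls ctx pol z b τ + visits ctx z *
        (2 * √(8 * F.gap ^ 2 * ∑ τ, F.law ctx pol θ τ * F.pulls ctx pol z b τ)) := by
  set L : (Fin K → Trajectory 𝓢 𝓐 (n + 1)) → ℝ :=
    fun τ => ∏ k, F.ratio z b (ctx k) ((τ k).2 0) ((τ k).1 1) with hL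
  have hupd : ∀ τ, F.law ctx pol (Function.update θ z (some b)) τ = F.law ctx pol θ τ * L τ :=
    F.law_update ctx pol hz b
  have h1 := sum_mul_abs_sub_one_le (F.law_nonneg ctx pol θ) (F.sum_law ctx pol θ)
    (L := L) (fun τ => Finset.prod_pos fun k _ => F.ratio_pos _ _ _ _ _)
    (by simp only [← hupd]; exact F.sum_law ctx pol _)
  have h2 := h1.trans (mul_le_mul_of_nonneg_left
    (Real.sqrt_le_sqrt (F.sum_law_mul_neg_log_le ctx pol hz b)) zero_le_two)
  refine le_trans ?_ (add_le_add le_rfl (mul_le_mul_of_nonneg_left h2 (visits_nonneg ctx z)))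
  rw [Finset.mul_sum, ← Finset.sum_add_distrib]
  refine Finset.sum_le_sum fun τ _ => ?_
  rw [hupd]
  have a := F.law_nonneg ctx pol θ τ
  have b1 := F.pulls_nonneg ctx pol z b τ
  have b2 := F.pulls_le ctx pol z b τ
  have key : (L τ - 1) * F.pulls ctx pol z b τ ≤ |L τ - 1| * visits ctx z :=
    mul_le_mul (le_abs_self _) b2 b1 (abs_nonneg _)
  nlinarith [mul_le_mul_of_nonneg_left key a]

open Classical in
/-- On average over the good arm `b` of the context `z`, a quarter of the choices in this context
is bad. -/
theorem le_sum_sum_law_update_mul [Fintype B] (hB : 2 ≤ Fintype.card B) {θ : C → Option B} {z : C}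
    (hz : θ z = none) (hgap : 512 * F.gap ^ 2 * visits ctx z ≤ Fintype.card B) :
    (Fintype.card B : ℝ) * visits ctx z / 4 ≤ ∑ b, ∑ τ,
      F.law ctx pol (Function.update θ z (some b)) τ *
        (visits ctx z - F.pulls ctx pol z b τ) := by
  set N : ℝ := (Fintype.card B : ℝ) with hN
  set V := visits ctx z with hV
  have hN2 : (2 : ℝ) ≤ N := by
    rw [hN]
    exact_mod_cast hB
  have hV0 : 0 ≤ V := visits_nonneg ctx z
  set y : B → ℝ := fun b => ∑ τ, F.law ctx pol θ τ * F.pulls ctx pol z b τ with hy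
  have hy0 : ∀ b, 0 ≤ y b := fun b => Finset.sum_nonneg fun τ _ =>
    mul_nonneg (F.law_nonneg ctx pol θ τ) (F.pulls_nonneg ctx pol z b τ)
  have hysum : ∑ b, y b = V := by
    simp only [hy]
    rw [Finset.sum_comm]
    simp only [← Finset.mul_sum, F.sum_pulls, ← Finset.sum_mul, F.sum_law, one_mul, hV]
  -- By Cauchy–Schwarz over the arms the square is at most `32 * N * gap ^ 2 * V`, as the pulls add
  -- up to `V`. The constant `512 = 32 * 16` in the hypothesis makes this at most `(N / 4) ^ 2`.
  have hsq : ∑ b, 2 * √(8 * F.gap ^ 2 * y b) ≤ N / 4 := by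
    refine abs_le_of_sq_le_sq' ?_ (by linarith) |>.2
    have h := sq_sum_le_card_mul_sum_sq (s := Finset.univ) (f := fun b => 2 * √(8 * F.gap ^ 2 * y b))
    refine h.trans ?_
    have e : ∀ b, (2 * √(8 * F.gap ^ 2 * y b)) ^ 2 = 32 * F.gap ^ 2 * y b := by
      intro b
      rw [mul_pow, Real.sq_sqrt (mul_nonneg (by positivity) (hy0 b))]
      ring
    simp only [e, ← Finset.mul_sum, hysum, Finset.card_univ]
    rw [← hN]
    nlinarith
  have h1 : ∀ b, ∑ τ, F.law ctx pol (Function.update θ z (some b)) τ *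
      (V - F.pulls ctx pol z b τ) = V -
        ∑ τ, F.law ctx pol (Function.update θ z (some b)) τ * F.pulls ctx pol z b τ := by
    intro b
    simp only [mul_sub, Finset.sum_sub_distrib, ← Finset.sum_mul, F.sum_law, one_mul]
  have h2 := Finset.sum_le_sum fun b (_ : b ∈ Finset.univ) =>
    F.sum_law_update_mul_pulls_le ctx pol hz b
  rw [Finset.sum_add_distrib, ← Finset.mul_sum] at h2
  simp only [h1, Finset.sum_sub_distrib, Finset.sum_const, Finset.card_univ, nsmul_eq_mul]
  have h3 : V * ∑ b, 2 * √(8 * F.gap ^ 2 * y b) ≤ V * (N / 4) :=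
    mul_le_mul_of_nonneg_left hsq hV0
  have h4 : ∑ b, y b = V := hysum
  simp only [hy] at h3 h4
  rw [h4] at h2
  rw [← hN]
  -- The pulls of the good arm, summed over `b`, are at most `V + V * N / 4`; since `N ≥ 2`,
  -- subtracting this from `N * V` leaves at least `N * V / 4`.
  nlinarith

/-- Exchanging the entry `θ z` with `b` is an involution of the pairs `(θ, b)`. This lets the bound
for one context, with the other good arms frozen, be averaged over all `θ`. -/
theorem sum_sum_update {C B : Type*} [DecidableEq C] [Fintype C] [Fintype B] (z : C)
    (f : (C → B) → ℝ) :
    ∑ θ, ∑ b, f (Function.update θ z b) = Fintype.card B * ∑ θ, f θ := by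
  have e : Function.Involutive fun x : (C → B) × B => (Function.update x.1 z x.2, x.1 z) := by
    rintro ⟨θ, b⟩
    simp
  have h := (Equiv.sum_comp e.toPerm fun x : (C → B) × B => f x.1)
  rw [Fintype.sum_prod_type, Fintype.sum_prod_type] at h
  simp only [Finset.sum_const, Finset.card_univ, nsmul_eq_mul, ← Finset.mul_sum] at h
  exact h

open Classical in
/-- Averaged over the hidden good arms, a quarter of all first actions is bad. -/
theorem le_sum_sum_law_mul [Fintype C] [Fintype B] (hB : 2 ≤ Fintype.card B)
    (hgap : ∀ z, 512 * F.gap ^ 2 * visits ctx z ≤ Fintype.card B) :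
    (Fintype.card (C → B) : ℝ) * (K / 4) ≤ ∑ θ : C → B, ∑ τ,
      F.law ctx pol (fun c => some (θ c)) τ *
        ∑ k, (1 - F.armProb (pol k (pastOf τ k)) (ctx k) (θ (ctx k))) := by
  have hN : (0 : ℝ) < Fintype.card B := by
    have : 0 < Fintype.card B := by omega
    exact_mod_cast this
  set f : C → (C → B) → ℝ := fun z θ => ∑ τ, F.law ctx pol (fun c => some (θ c)) τ *
    (visits ctx z - F.pulls ctx pol z (θ z) τ) with hf
  have hsplit : ∀ (θ : C → B) (τ : Fin K → Trajectory 𝓢 𝓐 (n + 1)),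
      ∑ k, (1 - F.armProb (pol k (pastOf τ k)) (ctx k) (θ (ctx k))) =
      ∑ z, (visits ctx z - F.pulls ctx pol z (θ z) τ) := by
    intro θ τ
    unfold visits pulls
    simp only [← Finset.sum_sub_distrib]
    rw [Finset.sum_comm]
    refine Finset.sum_congr rfl fun k _ => ?_
    rw [Finset.sum_eq_single (ctx k)]
    · simp
    · intro z _ hz
      simp [hz.symm]
    · simp
  have hvis : ∑ z, visits ctx z = K := by
    unfold visits
    rw [Finset.sum_comm]
    simp
  have hz : ∀ z, (Fintype.card (C → B) : ℝ) * (visits ctx z / 4) ≤ ∑ θ, f z θ := by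
    intro z
    have h1 : ∀ θ : C → B, (Fintype.card B : ℝ) * visits ctx z / 4 ≤
        ∑ b, f z (Function.update θ z b) := by
      intro θ
      -- The reference instance forgets the good arm of `z` only; the other contexts keep theirs.
      have := F.le_sum_sum_law_update_mul ctx pol hB
        (θ := Function.update (fun c => some (θ c)) z none) (z := z) (by simp) (hgap z)
      refine this.trans (le_of_eq (Finset.sum_congr rfl fun b _ => ?_))
      have e : Function.update (Function.update (fun c => some (θ c)) z none) z (some b) =
          fun c => some (Function.update θ z b c) := by
        funext c
        by_cases hc : c = z
        · subst hc; simp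
        · simp [hc]
      simp only [hf, e, Function.update_self]
    have h2 := Finset.sum_le_sum fun θ (_ : θ ∈ Finset.univ) => h1 θ
    rw [sum_sum_update, Finset.sum_const, Finset.card_univ, nsmul_eq_mul] at h2
    refine le_of_mul_le_mul_left (le_trans (le_of_eq ?_) h2) hN
    ring
  have h3 := Finset.sum_le_sum fun z (_ : z ∈ Finset.univ) => hz z
  rw [← Finset.mul_sum, ← Finset.sum_div, hvis, Finset.sum_comm] at h3
  refine h3.trans (le_of_eq (Finset.sum_congr rfl fun θ _ => ?_))
  simp only [hf, hsplit]
  rw [Finset.sum_comm]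
  exact Finset.sum_congr rfl fun τ _ => (Finset.mul_sum _ _ _).symm

end HardFamily

/-! ### Integrating over the seed -/

section Integrability

variable {Ω : Type v} [MeasurableSpace Ω] {𝓢 𝓐 : Type u} [Fintype 𝓢] [Fintype 𝓐] {H K : ℕ}

theorem measurable_trajProb (P : 𝓢 → 𝓐 → stdSimplex ℝ 𝓢) {π : Ω → Policy 𝓢 𝓐 H}
    (hπ : Measurable π) (s : 𝓢) (τ : Trajectory 𝓢 𝓐 H) :
    Measurable fun ω => trajProb P (π ω) s τ := by
  unfold trajProb
  refine Measurable.const_mul (Finset.measurable_prod _ fun h _ => Measurable.mul_const ?_ _) _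
  have h1 : Measurable fun ω => π ω h (τ.1 h.castSucc) :=
    (measurable_pi_apply _).comp ((measurable_pi_apply h).comp hπ)
  exact (measurable_pi_apply (τ.2 h)).comp (measurable_subtype_coe.comp h1)

theorem measurable_value (P : 𝓢 → 𝓐 → stdSimplex ℝ 𝓢) (R : 𝓢 → 𝓐 → ℝ)
    {π : Ω → Policy 𝓢 𝓐 H} (hπ : Measurable π) (s : 𝓢) :
    Measurable fun ω => value P R (π ω) s :=
  Finset.measurable_sum _ fun τ _ => (measurable_trajProb P hπ s τ).mul_const _

theorem integrable_sum_prod_trajProb_mul_regret (P : 𝓢 → 𝓐 → stdSimplex ℝ 𝓢) {R : 𝓢 → 𝓐 → ℝ}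
    (hR : ∀ s a, R s a ∈ Set.Icc (0 : ℝ) 1) (s₁ : Fin K → 𝓢) (μ : Measure Ω)
    [IsProbabilityMeasure μ] (alg : Algorithm Ω 𝓢 𝓐 H K) :
    Integrable (fun ω => ∑ τ : Fin K → Trajectory 𝓢 𝓐 H,
      (∏ k : Fin K, trajProb P (alg.played R s₁ ω τ k) (s₁ k) (τ k)) *
        regret P R s₁ alg ω τ) μ := by
  have hm : ∀ (τ : Fin K → Trajectory 𝓢 𝓐 H) k, Measurable fun ω => alg.played R s₁ ω τ k :=
    fun τ k => alg.measurable_policy _ _ _ _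
  -- For each seed the path probabilities sum to 1, so a bound valid on every path bounds the
  -- weighted sum.
  refine Integrable.of_bound (C := ∑ k : Fin K, (|optValue H P R (s₁ k)| + H)) ?_ ?_
  · refine (Finset.measurable_sum _ fun τ _ => Measurable.mul ?_ ?_).aestronglyMeasurable
    · exact Finset.measurable_prod _ fun k _ => measurable_trajProb P (hm τ k) _ _
    · exact Finset.measurable_sum _ fun k _ =>
        (measurable_value P R (hm τ k) _).const_sub _
  · refine Filter.Eventually.of_forall fun ω => ?_
    have h1 : ∑ τ : Fin K → Trajectory 𝓢 𝓐 H,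
        (∏ k : Fin K, trajProb P (alg.played R s₁ ω τ k) (s₁ k) (τ k)) = 1 :=
      sum_pathProb (w := fun k past => trajProb P (alg.policy R k past (s₁ k) ω) (s₁ k))
        fun _ _ => sum_trajProb _ _ _
    rw [← one_mul (∑ k : Fin K, _), ← h1, Finset.sum_mul]
    refine (norm_sum_le _ _).trans (Finset.sum_le_sum fun τ _ => ?_)
    have h0 : 0 ≤ ∏ k : Fin K, trajProb P (alg.played R s₁ ω τ k) (s₁ k) (τ k) :=
      Finset.prod_nonneg fun k _ => trajProb_nonneg _ _ _ _
    rw [norm_mul, Real.norm_of_nonneg h0]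
    refine mul_le_mul_of_nonneg_left ?_ h0
    refine (norm_sum_le _ _).trans (Finset.sum_le_sum fun k _ => ?_)
    exact (norm_sub_le _ _).trans (add_le_add le_rfl (abs_value_le hR _ _))

end Integrability

/-! ### From the average over instances to a single bad instance -/

namespace HardFamily

variable {𝓢 𝓐 C B : Type u} [Fintype 𝓢] [Fintype 𝓐] (F : HardFamily 𝓢 𝓐 C B) {n K : ℕ}

/-- Some choice of the good arms makes the expected regret large. -/
theorem exists_le_expectedRegret [Fintype C] [Fintype B] (hB : 2 ≤ Fintype.card B)
    (ctx : Fin K → C) (hgap : ∀ z, 512 * F.gap ^ 2 * visits ctx z ≤ Fintype.card B)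
    {Ω : Type v} [MeasurableSpace Ω] (μ : Measure Ω) [IsProbabilityMeasure μ]
    (alg : Algorithm Ω 𝓢 𝓐 (n + 1) K) :
    ∃ θ : C → B, n * F.gap * (K / 4) ≤ expectedRegret (F.P fun c => some (θ c)) F.reward
      (fun k => F.init (ctx k)) μ alg := by
  classical
  have : Nonempty B := Fintype.card_pos_iff.1 (by omega)
  by_contra! hlt
  set Φ : (C → B) → Ω → ℝ := fun θ ω => ∑ τ : Fin K → Trajectory 𝓢 𝓐 (n + 1),
    (∏ k : Fin K, trajProb (F.P fun c => some (θ c))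
      (alg.played F.reward (fun k => F.init (ctx k)) ω τ k) (F.init (ctx k)) (τ k)) *
        regret (F.P fun c => some (θ c)) F.reward (fun k => F.init (ctx k)) alg ω τ with hΦ
  have hint : ∀ θ, Integrable (Φ θ) μ := fun θ =>
    integrable_sum_prod_trajProb_mul_regret _ F.reward_mem _ μ alg
  have hsum : ∑ θ, ∫ ω, Φ θ ω ∂μ < (Fintype.card (C → B) : ℝ) * (n * F.gap * (K / 4)) := by
    have := Finset.sum_lt_sum_of_nonempty (Finset.univ_nonempty (α := C → B)) fun θ _ => hlt θ
    simpa [expectedRegret] using this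
  rw [← integral_finsetSum _ fun θ _ => hint θ] at hsum
  refine absurd hsum (not_lt.2 ?_)
  -- With the seed fixed the policies are functions of the past alone. They are the same functions
  -- for every `θ`, because the reward does not depend on `θ`.
  have hpt : ∀ ω, (Fintype.card (C → B) : ℝ) * (n * F.gap * (K / 4)) ≤ ∑ θ, Φ θ ω := by
    intro ω
    have h1 := F.le_sum_sum_law_mul ctx
      (fun k past => alg.policy F.reward k past (F.init (ctx k)) ω) hB hgap
    have h2 := mul_le_mul_of_nonneg_left h1
      (mul_nonneg (Nat.cast_nonneg (α := ℝ) n) F.gap_nonneg)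
    refine le_trans (le_of_eq (by ring)) (h2.trans ?_)
    rw [Finset.mul_sum]
    refine Finset.sum_le_sum fun θ _ => ?_
    rw [Finset.mul_sum]
    refine Finset.sum_le_sum fun τ _ => ?_
    rw [mul_left_comm]
    refine mul_le_mul_of_nonneg_left ?_ (F.law_nonneg ctx _ _ τ)
    rw [Finset.mul_sum]
    exact Finset.sum_le_sum fun k _ => F.le_optValue_sub_value rfl _
  calc _ = ∫ _, (Fintype.card (C → B) : ℝ) * (n * F.gap * (K / 4)) ∂μ := by simp
    _ ≤ _ := integral_mono (integrable_const _) (integrable_finsetSum _ fun θ _ => hint θ) hpt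

end HardFamily

/-- Contexts can be assigned to episodes almost equally often. -/
theorem exists_balanced {C : Type*} [Fintype C] [Nonempty C] {K : ℕ} (hK : Fintype.card C ≤ K) :
    ∃ ctx : Fin K → C, ∀ z, HardFamily.visits ctx z ≤ 2 * K / Fintype.card C := by
  classical
  set M := Fintype.card C with hM
  have hM0 : 0 < M := Fintype.card_pos
  let e := (Fintype.equivFin C).symm
  -- Contexts are served cyclically. Episodes with the same context differ in `k / M`, so there are
  -- at most `K / M + 1` of them, and `K ≥ M` absorbs the `1`.
  refine ⟨fun k => e ⟨k % M, Nat.mod_lt _ hM0⟩, fun z => ?_⟩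
  have h1 : (Finset.univ.filter fun k : Fin K => e ⟨k % M, Nat.mod_lt _ hM0⟩ = z).card ≤
      K / M + 1 := by
    rw [← Finset.card_range (K / M + 1)]
    refine Finset.card_le_card_of_injOn (fun k => (k : ℕ) / M) ?_ ?_
    · intro k _
      simp only [Finset.coe_range, Set.mem_Iio]
      exact Nat.lt_succ_of_le (Nat.div_le_div_right k.isLt.le)
    · intro k hk l hl hkl
      simp only [Finset.coe_filter, Finset.mem_univ, true_and, Set.mem_ofPred_eq] at hk hl
      have h := e.injective (hk.trans hl.symm)
      rw [Fin.mk.injEq] at h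
      refine Fin.ext ?_
      rw [← Nat.div_add_mod k M, ← Nat.div_add_mod l M, h]
      simp only at hkl
      rw [hkl]
  have h2 : HardFamily.visits (fun k : Fin K => e ⟨k % M, Nat.mod_lt _ hM0⟩) z ≤
      ((K / M + 1 : ℕ) : ℝ) := by
    unfold HardFamily.visits
    rw [Finset.sum_boole]
    refine le_trans (le_of_eq ?_) (Nat.cast_le.2 h1)
    congr
  refine h2.trans ?_
  have hM' : (0 : ℝ) < M := by exact_mod_cast hM0
  have h3 : ((K / M : ℕ) : ℝ) ≤ (K : ℝ) / M := Nat.cast_div_le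
  have h4 : (1 : ℝ) ≤ (K : ℝ) / M := by
    rw [le_div_iff₀ hM', one_mul]
    exact_mod_cast hK
  push_cast
  rw [mul_div_assoc]
  linarith

/-! ### Hard instances with a given factored structure -/

section Relay

open Classical in
/-- The law that gives mass `q` to `x` and `1 - q` to `y`. -/
def twoPoint {X : Type*} [Fintype X] (x y : X) (q : ℝ) (hq : q ∈ Set.Icc (0 : ℝ) 1) :
    stdSimplex ℝ X :=
  ⟨fun u => q * (if u = x then 1 else 0) + (1 - q) * (if u = y then 1 else 0), by
    refine ⟨fun u => ?_, ?_⟩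
    · exact add_nonneg (mul_nonneg hq.1 (by split_ifs <;> norm_num))
        (mul_nonneg (sub_nonneg.2 hq.2) (by split_ifs <;> norm_num))
    · simp [Finset.sum_add_distrib]⟩

section TwoPoint

variable {X : Type*} [Fintype X] {x y : X} {q : ℝ} (hq : q ∈ Set.Icc (0 : ℝ) 1)

theorem twoPoint_left (hxy : y ≠ x) : (twoPoint x y q hq).1 x = q := by
  simp [twoPoint, hxy.symm]

theorem twoPoint_right (hxy : y ≠ x) : (twoPoint x y q hq).1 y = 1 - q := by
  simp [twoPoint, hxy]

theorem twoPoint_of_ne {u : X} (hx : u ≠ x) (hy : u ≠ y) : (twoPoint x y q hq).1 u = 0 := by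
  simp [twoPoint, hx, hy]

theorem eq_or_eq_of_twoPoint_ne_zero {u : X} (hu : (twoPoint x y q hq).1 u ≠ 0) :
    u = x ∨ u = y := by
  by_contra! h
  exact hu (twoPoint_of_ne hq h.1 h.2)

theorem eq_left_of_twoPoint_ne_zero (h1 : q = 1) {u : X} (hu : (twoPoint x y q hq).1 u ≠ 0) :
    u = x := by
  by_contra h
  simp [twoPoint, h1, h] at hu

theorem eq_right_of_twoPoint_ne_zero (h0 : q = 0) {u : X} (hu : (twoPoint x y q hq).1 u ≠ 0) :
    u = y := by
  by_contra h
  simp [twoPoint, h0, h] at hu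

open Classical in
theorem sum_twoPoint_half (hxy : y ≠ x) (h2 : q = 1 / 2) :
    ∑ u, (twoPoint x y q hq).1 u * (if u = x then 1 else -1) = 0 := by
  simp only [twoPoint, add_mul, Finset.sum_add_distrib, mul_assoc, ← Finset.mul_sum, ite_mul,
    one_mul, zero_mul, Finset.sum_ite_eq', Finset.mem_univ, if_true, if_neg hxy]
  rw [h2]
  norm_num

end TwoPoint

variable {m p : ℕ}

/-- A set of state components along which a token travels from the component `i` back to a
component `gate` in the scope of `i`, and three values that the components can take. -/
structure Relay (S : Fin m → Type u) (Z : Fin m → Finset (Fin m ⊕ Fin p)) (i : Fin m) where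
  carriers : Finset (Fin m)
  gate : Fin m
  gate_mem : gate ∈ carriers
  self_mem : i ∈ carriers
  gate_scope : Sum.inl gate ∈ Z i
  not_scope : ∀ d ∈ carriers, d ≠ gate → Sum.inl d ∉ Z i
  next : ∀ d ∈ carriers, d ≠ gate → ∃ d' ∈ carriers, Sum.inl d ∈ Z d'
  off : ∀ j, S j
  on : ∀ j, S j
  fresh : S gate
  off_ne_on : ∀ j, off j ≠ on j
  fresh_ne_off : fresh ≠ off gate
  fresh_ne_on : fresh ≠ on gate

/-- Follow the chain from `c` and stop at its first member that lies in the scope of `i`: this is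
`b`, and no earlier member is in that scope. Stopping early ensures that the scope of `i` meets the
chosen set in one component only. -/
theorem exists_carriers {Z : Fin m → Finset (Fin m ⊕ Fin p)} {c i : Fin m}
    (h : Relation.TransGen (Influences Z) c i) :
    ∃ (D : Finset (Fin m)) (b : Fin m), b ∈ D ∧ c ∈ D ∧ Sum.inl b ∈ Z i ∧
      ∀ d ∈ D, d ≠ b → Sum.inl d ∉ Z i ∧ ∃ d' ∈ D, Sum.inl d ∈ Z d' := by
  have base : ∀ c : Fin m, Sum.inl c ∈ Z i →
      ∃ (D : Finset (Fin m)) (b : Fin m), b ∈ D ∧ c ∈ D ∧ Sum.inl b ∈ Z i ∧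
        ∀ d ∈ D, d ≠ b → Sum.inl d ∉ Z i ∧ ∃ d' ∈ D, Sum.inl d ∈ Z d' := fun c hc =>
    ⟨{c}, c, by simp, by simp, hc, fun d hd hne => absurd (Finset.mem_singleton.1 hd) hne⟩
  induction h using Relation.TransGen.head_induction_on with
  | single h => exact base _ h
  | @head c d hcd _ ih =>
    by_cases hc : Sum.inl c ∈ Z i
    · exact base c hc
    obtain ⟨D, b, hb, hd, hbi, hD⟩ := ih
    refine ⟨insert c D, b, Finset.mem_insert_of_mem hb, Finset.mem_insert_self _ _, hbi, ?_⟩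
    intro e he hne
    rcases Finset.mem_insert.1 he with rfl | he
    · exact ⟨hc, d, Finset.mem_insert_of_mem hd, hcd⟩
    · obtain ⟨h1, d', hd', h2⟩ := hD e he hne
      exact ⟨h1, d', Finset.mem_insert_of_mem hd', h2⟩

theorem nonempty_relay (S : Fin m → Type u) [∀ i, Fintype (S i)]
    {Z : Fin m → Finset (Fin m ⊕ Fin p)} (hS : ∀ i, 3 ≤ Fintype.card (S i)) {i : Fin m}
    (hi : HasLoop Z i) : Nonempty (Relay S Z i) := by
  obtain ⟨D, b, hb, hiD, hbi, hD⟩ := exists_carriers hi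
  have h3 : ∀ j, ∃ x y z : S j, x ≠ y ∧ x ≠ z ∧ y ≠ z := fun j =>
    Fintype.two_lt_card_iff.1 (hS j)
  choose x y z hxy hxz hyz using h3
  exact ⟨⟨D, b, hb, hiD, hbi, fun d hd hne => (hD d hd hne).1, fun d hd hne => (hD d hd hne).2,
    x, y, z b, hxy, (hxz b).symm, (hyz b).symm⟩⟩

/-! ### The instance attached to a relay: coin, memory and transition law -/

namespace Relay

variable {S : Fin m → Type u} {A : Fin p → Type u}
  {Z : Fin m → Finset (Fin m ⊕ Fin p)} {i : Fin m} (L : Relay S Z i)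

/-- The values of the state components in the scope of `i`, with a fresh value at the gate. -/
abbrev Context : Type u :=
  {c : (j : {j // Sum.inl j ∈ Z i}) → S j.1 //
    c ⟨L.gate, L.gate_scope⟩ ≠ L.on L.gate ∧ c ⟨L.gate, L.gate_scope⟩ ≠ L.off L.gate}

variable (A Z i) in
/-- The values of the action components in the scope of `i`. -/
abbrev Arm : Type u := (j : {j : Fin p // Sum.inr j ∈ Z i}) → A j.1

variable (A Z i) in
/-- The arm of an action. -/
def armOf (a : ∀ j, A j) : Arm A Z i := fun j => a j.1

/-- Some carrier holds the token. -/
def Good (s : ∀ i, S i) : Prop := ∃ d ∈ L.carriers, s d = L.on d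

open Classical in
/-- The probability that component `i` is switched on, given the values in its scope. -/
def selfProb (g : ℝ) (θ : L.Context → Option (Arm A Z i)) (x : ScopeSpace S A (Z i)) : ℝ :=
  if h : x ⟨Sum.inl L.gate, L.gate_scope⟩ = L.on L.gate then 1
  else if h' : x ⟨Sum.inl L.gate, L.gate_scope⟩ = L.off L.gate then 0
  else 1 / 2 + if θ ⟨fun j : {j // Sum.inl j ∈ Z i} => x ⟨Sum.inl j.1, j.2⟩, h, h'⟩ =
    some fun j : {j // Sum.inr j ∈ Z i} => x ⟨Sum.inr j.1, j.2⟩ then g else 0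

open Classical in
/-- The probability that component `j` is switched on, given the values in its scope. -/
def onProb (g : ℝ) (θ : L.Context → Option (Arm A Z i)) (j : Fin m)
    (x : ScopeSpace S A (Z j)) : ℝ :=
  if h : j = i then L.selfProb g θ fun c => x ⟨c.1, h ▸ c.2⟩
  else if j ∈ L.carriers ∧ ∃ d ∈ L.carriers, ∃ h : Sum.inl d ∈ Z j, x ⟨Sum.inl d, h⟩ = L.on d
    then 1 else 0

theorem onProb_mem {g : ℝ} (hg : g ∈ Set.Icc (0 : ℝ) (1 / 4))
    (θ : L.Context → Option (Arm A Z i)) (j : Fin m) (x : ScopeSpace S A (Z j)) :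
    L.onProb g θ j x ∈ Set.Icc (0 : ℝ) 1 := by
  obtain ⟨h0, h1⟩ := hg
  unfold onProb selfProb
  split_ifs <;> constructor <;> linarith

open Classical in
/-- The initial state that presents the context `z`. -/
def start (z : L.Context) (j : Fin m) : S j :=
  if h : Sum.inl j ∈ Z i then z.1 ⟨j, h⟩ else L.off j

variable {L} {g : ℝ}

open Classical in
theorem onProb_pair_of_ne (θ : L.Context → Option (Arm A Z i)) {j : Fin m} (hj : j ≠ i)
    (s : ∀ i, S i) (a : ∀ j, A j) :
    L.onProb g θ j (fun c => pair s a c.1) =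
      if j ∈ L.carriers ∧ ∃ d ∈ L.carriers, Sum.inl d ∈ Z j ∧ s d = L.on d then 1 else 0 := by
  unfold onProb
  rw [dif_neg hj]
  simp only [pair, exists_prop]

theorem onProb_pair_self_of_on (θ : L.Context → Option (Arm A Z i))
    {s : ∀ i, S i} (a : ∀ j, A j) (hs : s L.gate = L.on L.gate) :
    L.onProb g θ i (fun c => pair s a c.1) = 1 := by
  unfold onProb selfProb
  rw [dif_pos rfl, dif_pos]
  exact hs

theorem onProb_pair_self_of_off (θ : L.Context → Option (Arm A Z i))
    {s : ∀ i, S i} (a : ∀ j, A j) (hs : s L.gate = L.off L.gate) :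
    L.onProb g θ i (fun c => pair s a c.1) = 0 := by
  unfold onProb selfProb
  rw [dif_pos rfl, dif_neg, dif_pos]
  · exact hs
  · exact fun h => L.off_ne_on _ (hs.symm.trans h)

theorem start_of_mem (z : L.Context) {j : Fin m} (h : Sum.inl j ∈ Z i) :
    L.start z j = z.1 ⟨j, h⟩ := dif_pos h

open Classical in
theorem onProb_pair_start (θ : L.Context → Option (Arm A Z i)) (z : L.Context) (a : ∀ j, A j) :
    L.onProb g θ i (fun c => pair (L.start z) a c.1) =
      1 / 2 + if θ z = some (armOf A Z i a) then g else 0 := by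
  have e := start_of_mem z L.gate_scope
  have e' : (fun j : {j // Sum.inl j ∈ Z i} => L.start z j.1) = z.1 :=
    funext fun j => start_of_mem z j.2
  unfold onProb selfProb
  rw [dif_pos rfl, dif_neg, dif_neg]
  · congr 1
    refine if_congr ?_ rfl rfl
    have : ∀ h, (⟨fun j : {j // Sum.inl j ∈ Z i} => L.start z j.1, h⟩ : L.Context) = z := fun h => Subtype.ext e'
    exact Iff.of_eq (congrArg (fun t => θ t = _) (this _))
  · exact fun h => z.2.2 (e.symm.trans h)
  · exact fun h => z.2.1 (e.symm.trans h)

/-- The gate carries a value other than on and off, and every other carrier lies outside the scope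
of `i`, hence starts off. -/
theorem not_on_start (z : L.Context) {d : Fin m} (hd : d ∈ L.carriers) :
    L.start z d ≠ L.on d := by
  by_cases h : d = L.gate
  · subst h
    rw [start_of_mem z L.gate_scope]
    exact z.2.1
  · unfold start
    rw [dif_neg (L.not_scope d hd h)]
    exact L.off_ne_on d

variable [∀ i, Fintype (S i)]

variable (L) in
open Classical in
/-- The hard instance with the good arms `θ`. -/
def fmdp (hg : g ∈ Set.Icc (0 : ℝ) (1 / 4)) (θ : L.Context → Option (Arm A Z i)) :
    FMDP S A Z where
  P j x := twoPoint (L.on j) (L.off j) (L.onProb g θ j x) (L.onProb_mem hg θ j x)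
  R s _ := if L.Good s then 1 else 0
  R_mem s a := by split_ifs <;> simp

variable (hg : g ∈ Set.Icc (0 : ℝ) (1 / 4))

theorem transition_apply (θ : L.Context → Option (Arm A Z i)) (s s' : ∀ i, S i) (a : ∀ j, A j) :
    ((L.fmdp hg θ).transition s a).1 s' =
      ∏ j, (twoPoint (L.on j) (L.off j) (L.onProb g θ j fun c => pair s a c.1)
        (L.onProb_mem hg θ j _)).1 (s' j) :=
  rfl

theorem factor_ne_zero {θ : L.Context → Option (Arm A Z i)} {s s' : ∀ i, S i} {a : ∀ j, A j}
    (h : ((L.fmdp hg θ).transition s a).1 s' ≠ 0) (j : Fin m) :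
    (twoPoint (L.on j) (L.off j) (L.onProb g θ j fun c => pair s a c.1)
      (L.onProb_mem hg θ j _)).1 (s' j) ≠ 0 :=
  Finset.prod_ne_zero_iff.1 (transition_apply hg θ s s' a ▸ h) j (Finset.mem_univ j)

theorem settled_of_ne_zero {θ : L.Context → Option (Arm A Z i)} {s s' : ∀ i, S i} {a : ∀ j, A j}
    (h : ((L.fmdp hg θ).transition s a).1 s' ≠ 0) (j : Fin m) :
    s' j = L.on j ∨ s' j = L.off j :=
  eq_or_eq_of_twoPoint_ne_zero _ (factor_ne_zero hg h j)

/-- The memory is exact. If no carrier is on, the gate is off, so `i` and all other carriers come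
out off. A token at the gate is copied to `i`; a token elsewhere is copied to its successor, which
is not `i` because only the gate is visible to `i`. -/
theorem good_iff {θ : L.Context → Option (Arm A Z i)} {s s' : ∀ i, S i} {a : ∀ j, A j}
    (hs : s L.gate = L.on L.gate ∨ s L.gate = L.off L.gate)
    (h : ((L.fmdp hg θ).transition s a).1 s' ≠ 0) :
    L.Good s' ↔ L.Good s := by
  classical
  constructor
  · rintro ⟨d, hd, hon⟩
    by_contra hno
    have h0 : L.onProb g θ d (fun c => pair s a c.1) = 0 := by
      by_cases hdi : d = i
      · subst hdi
        refine onProb_pair_self_of_off θ a (hs.resolve_left fun e => hno ⟨_, L.gate_mem, e⟩)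
      · rw [onProb_pair_of_ne θ hdi, if_neg]
        rintro ⟨_, d', hd', _, e⟩
        exact hno ⟨d', hd', e⟩
    have := eq_right_of_twoPoint_ne_zero _ h0 (factor_ne_zero hg h d)
    exact L.off_ne_on d (this.symm.trans hon)
  · rintro ⟨d, hd, hon⟩
    by_cases hdg : d = L.gate
    · subst hdg
      exact ⟨i, L.self_mem, eq_left_of_twoPoint_ne_zero _ (onProb_pair_self_of_on θ a hon)
        (factor_ne_zero hg h i)⟩
    · obtain ⟨d', hd', hz⟩ := L.next d hd hdg
      have hne : d' ≠ i := by
        rintro rfl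
        exact L.not_scope d hd hdg hz
      refine ⟨d', hd', eq_left_of_twoPoint_ne_zero _ ?_ (factor_ne_zero hg h d')⟩
      rw [onProb_pair_of_ne θ hne, if_pos ⟨hd', d, hd, hz, hon⟩]

theorem transition_eq_of_settled (θ θ' : L.Context → Option (Arm A Z i)) {s : ∀ i, S i}
    (a : ∀ j, A j) (hs : s L.gate = L.on L.gate ∨ s L.gate = L.off L.gate) :
    (L.fmdp hg θ).transition s a = (L.fmdp hg θ').transition s a := by
  have : ∀ j, L.onProb g θ j (fun c => pair s a c.1) = L.onProb g θ' j fun c => pair s a c.1 := by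
    intro j
    by_cases hj : j = i
    · subst hj
      rcases hs with hs | hs
      · rw [onProb_pair_self_of_on θ a hs, onProb_pair_self_of_on θ' a hs]
      · rw [onProb_pair_self_of_off θ a hs, onProb_pair_self_of_off θ' a hs]
    · rw [onProb_pair_of_ne θ hj, onProb_pair_of_ne θ' hj]
  refine Subtype.ext (funext fun s' => ?_)
  simp only [transition_apply, this]

/-- From an initial state, only the component `i` can be switched on. -/
theorem good_iff_of_start {θ : L.Context → Option (Arm A Z i)} {z : L.Context} {s' : ∀ i, S i}
    {a : ∀ j, A j} (h : ((L.fmdp hg θ).transition (L.start z) a).1 s' ≠ 0) :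
    L.Good s' ↔ s' i = L.on i := by
  classical
  refine ⟨?_, fun h => ⟨i, L.self_mem, h⟩⟩
  rintro ⟨d, hd, hon⟩
  by_cases hdi : d = i
  · exact hdi ▸ hon
  have h0 : L.onProb g θ d (fun c => pair (L.start z) a c.1) = 0 := by
    rw [onProb_pair_of_ne θ hdi, if_neg]
    rintro ⟨_, d', hd', _, e⟩
    exact not_on_start z hd' e
  exact absurd ((eq_right_of_twoPoint_ne_zero _ h0 (factor_ne_zero hg h d)).symm.trans hon)
    (L.off_ne_on d)

/-- The good arms enter through the factor of `i` alone, so comparing two instances means comparing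
two laws on the values of `i`. -/
theorem transition_eq_mul (θ : L.Context → Option (Arm A Z i)) (s s' : ∀ i, S i)
    (a : ∀ j, A j) : ((L.fmdp hg θ).transition s a).1 s' =
      (twoPoint (L.on i) (L.off i) (L.onProb g θ i fun c => pair s a c.1)
        (L.onProb_mem hg θ i _)).1 (s' i) *
      ∏ j ∈ Finset.univ.erase i, ((L.fmdp hg fun _ => none).P j fun c => pair s a c.1).1 (s' j) := by
  rw [transition_apply, ← Finset.mul_prod_erase _ _ (Finset.mem_univ i)]
  congr 1
  refine Finset.prod_congr rfl fun j hj => ?_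
  have : L.onProb g θ j (fun c => pair s a c.1) =
      L.onProb g (fun _ => none) j fun c => pair s a c.1 := by
    rw [onProb_pair_of_ne _ (Finset.ne_of_mem_erase hj),
      onProb_pair_of_ne _ (Finset.ne_of_mem_erase hj)]
  simp only [fmdp, this]

-- The factor of `i` changes from `1 / 2` to `1 / 2 ± g`, that is, by the factor `1 ± 2 * g`; after
-- a start the next state is good exactly when `i` is on.
open Classical in
theorem transition_start_of_eq {θ : L.Context → Option (Arm A Z i)} {z : L.Context}
    {a : ∀ j, A j} (s' : ∀ i, S i) (h : θ z = some (armOf A Z i a)) :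
    ((L.fmdp hg θ).transition (L.start z) a).1 s' =
      ((L.fmdp hg fun _ => none).transition (L.start z) a).1 s' *
        (1 + 2 * g * if L.Good s' then 1 else -1) := by
  have q1 : L.onProb g θ i (fun c => pair (L.start z) a c.1) = 1 / 2 + g := by
    rw [onProb_pair_start, if_pos h]
  have q0 : L.onProb g (fun _ => none) i (fun c => pair (L.start z) a c.1) = 1 / 2 := by
    rw [onProb_pair_start, if_neg (by simp), add_zero]
  by_cases hne : ((L.fmdp hg fun _ => none).transition (L.start z) a).1 s' = 0
  -- Both coins charge exactly the on and off values, so the biased law vanishes wherever the fair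
  -- one does.
  · rw [hne, zero_mul]
    rw [transition_eq_mul] at hne ⊢
    rcases mul_eq_zero.1 hne with h0 | h0
    · by_cases hon : s' i = L.on i
      · rw [hon, twoPoint_left _ (L.off_ne_on i), q0] at h0
        norm_num at h0
      by_cases hoff : s' i = L.off i
      · rw [hoff, twoPoint_right _ (L.off_ne_on i), q0] at h0
        norm_num at h0
      rw [twoPoint_of_ne _ hon hoff, zero_mul]
    · rw [h0, mul_zero]
  · have hgood := good_iff_of_start hg hne
    have hset := settled_of_ne_zero hg hne i
    rw [transition_eq_mul hg θ, transition_eq_mul hg fun _ => none]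
    rcases hset with hon | hoff
    · rw [if_pos (hgood.2 hon), hon, twoPoint_left _ (L.off_ne_on i),
        twoPoint_left _ (L.off_ne_on i), q1, q0]
      ring
    · rw [if_neg (fun h => L.off_ne_on i (hoff.symm.trans (hgood.1 h))), hoff,
        twoPoint_right _ (L.off_ne_on i), twoPoint_right _ (L.off_ne_on i), q1, q0]
      ring

theorem transition_start_of_ne {θ : L.Context → Option (Arm A Z i)} {z : L.Context}
    {a : ∀ j, A j} (s' : ∀ i, S i) (h : θ z ≠ some (armOf A Z i a)) :
    ((L.fmdp hg θ).transition (L.start z) a).1 s' =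
      ((L.fmdp hg fun _ => none).transition (L.start z) a).1 s' := by
  classical
  have q : L.onProb g θ i (fun c => pair (L.start z) a c.1) =
      L.onProb g (fun _ => none) i (fun c => pair (L.start z) a c.1) := by
    rw [onProb_pair_start, onProb_pair_start, if_neg h, if_neg (by simp)]
  rw [transition_eq_mul hg θ, transition_eq_mul hg fun _ => none]
  simp only [q]

-- On the support the sign depends on component `i` only, so the sum factorizes over the components,
-- and the factor of the fair coin is zero.
open Classical in
theorem sum_transition_start (z : L.Context) (a : ∀ j, A j) :
    ∑ s', ((L.fmdp hg fun _ => none).transition (L.start z) a).1 s' *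
      (if L.Good s' then 1 else -1) = 0 := by
  have h1 : ∀ s' : ∀ i, S i, ((L.fmdp hg fun _ => none).transition (L.start z) a).1 s' *
      (if L.Good s' then 1 else -1) =
      ∏ j, (((L.fmdp hg fun _ => none).P j fun c => pair (L.start z) a c.1).1 (s' j) *
        if j = i then (if s' j = L.on j then 1 else -1) else 1) := by
    intro s'
    rw [Finset.prod_mul_distrib, Finset.prod_ite_eq' Finset.univ i, if_pos (Finset.mem_univ i)]
    by_cases h0 : ((L.fmdp hg fun _ => none).transition (L.start z) a).1 s' = 0
    · rw [h0, zero_mul]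
      have h0' : ∏ j, ((L.fmdp hg fun _ => none).P j fun c => pair (L.start z) a c.1).1 (s' j) = 0 :=
        h0
      rw [h0', zero_mul]
    · exact congrArg _ (if_congr (good_iff_of_start hg h0) rfl rfl)
  simp only [h1]
  rw [← Fintype.prod_sum fun j (u : S j) =>
    ((L.fmdp hg fun _ => none).P j fun c => pair (L.start z) a c.1).1 u *
      if j = i then (if u = L.on j then (1 : ℝ) else -1) else 1]
  refine Finset.prod_eq_zero (Finset.mem_univ i) ?_
  simp only [if_true]
  exact sum_twoPoint_half (L.onProb_mem hg _ i _) (L.off_ne_on i)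
    (by rw [onProb_pair_start, if_neg (by simp), add_zero])

variable (A) in
/-- The hard instances of a relay form a `HardFamily`. -/
def hardFamily [∀ j, Fintype (A j)] [∀ j, Nonempty (A j)] :
    HardFamily (∀ i, S i) (∀ j, A j) L.Context (Arm A Z i) where
  P θ := (L.fmdp hg θ).transition
  gap := g
  init := L.start
  arm := armOf A Z i
  settled s := s L.gate = L.on L.gate ∨ s L.gate = L.off L.gate
  good := L.Good
  gap_nonneg := hg.1
  gap_le := hg.2
  arm_surjective b := by
    classical
    refine ⟨fun j => if h : Sum.inr j ∈ Z i then b ⟨j, h⟩ else Classical.arbitrary _, ?_⟩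
    funext j
    exact dif_pos j.2
  not_good_init z := fun ⟨_, hd, h⟩ => not_on_start z hd h
  settled_init _ _ _ _ h := settled_of_ne_zero hg h _
  settled_step _ _ _ _ hs h := ⟨settled_of_ne_zero hg h _, good_iff hg hs h⟩
  eq_of_settled θ θ' _ a hs := transition_eq_of_settled hg θ θ' a hs
  apply_of_eq _ _ _ s' h := transition_start_of_eq hg s' h
  apply_of_ne _ _ _ s' h := transition_start_of_ne hg s' h
  balanced z a := sum_transition_start hg z a

end Relay

end Relay

/-! ### Counting contexts and arms against the size of the scope -/

section Cardinality

variable {m p : ℕ} {S : Fin m → Type u} {A : Fin p → Type u} {Z : Fin m → Finset (Fin m ⊕ Fin p)}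
  {i : Fin m}

theorem scopeSpace_ext {I : Finset (Fin m ⊕ Fin p)} {x y : ScopeSpace S A I}
    (hs : ∀ j (h : Sum.inl j ∈ I), x ⟨Sum.inl j, h⟩ = y ⟨Sum.inl j, h⟩)
    (ha : ∀ j (h : Sum.inr j ∈ I), x ⟨Sum.inr j, h⟩ = y ⟨Sum.inr j, h⟩) : x = y := by
  funext c
  obtain ⟨c | c, h⟩ := c
  · exact hs c h
  · exact ha c h

namespace Relay

variable (L : Relay S Z i)

/-- The value of a scope with given state and action components. -/
def scopeOf (z : L.Context) (b : Arm A Z i) : ScopeSpace S A (Z i)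
  | ⟨Sum.inl j, h⟩ => z.1 ⟨j, h⟩
  | ⟨Sum.inr j, h⟩ => b ⟨j, h⟩

theorem scopeOf_injective :
    Function.Injective fun zb : L.Context × Arm A Z i => L.scopeOf zb.1 zb.2 := by
  rintro ⟨z, b⟩ ⟨z', b'⟩ h
  have h' : L.scopeOf z b = L.scopeOf z' b' := h
  refine Prod.ext (Subtype.ext (funext fun j => ?_)) (funext fun j => ?_)
  · exact congrFun h' ⟨Sum.inl j.1, j.2⟩
  · exact congrFun h' ⟨Sum.inr j.1, j.2⟩

open Classical in
/-- Replace the value of the gate by a fresh one if it is not fresh. -/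
def refresh (x : ScopeSpace S A (Z i)) : L.Context :=
  if h : x ⟨Sum.inl L.gate, L.gate_scope⟩ ≠ L.on L.gate ∧
    x ⟨Sum.inl L.gate, L.gate_scope⟩ ≠ L.off L.gate
  then ⟨fun j : {j // Sum.inl j ∈ Z i} => x ⟨Sum.inl j.1, j.2⟩, h⟩
  else ⟨Function.update (fun j : {j // Sum.inl j ∈ Z i} => x ⟨Sum.inl j.1, j.2⟩)
    ⟨L.gate, L.gate_scope⟩ L.fresh, by simpa using ⟨L.fresh_ne_on, L.fresh_ne_off⟩⟩

theorem refresh_apply_of_ne (x : ScopeSpace S A (Z i)) (j : {j // Sum.inl j ∈ Z i})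
    (hj : j.1 ≠ L.gate) : (L.refresh x).1 j = x ⟨Sum.inl j.1, j.2⟩ := by
  unfold refresh
  split_ifs
  · rfl
  · have hne : j ≠ ⟨L.gate, L.gate_scope⟩ := fun h => hj (by rw [h])
    simp [hne]

theorem refresh_apply_gate (x : ScopeSpace S A (Z i))
    (h1 : x ⟨Sum.inl L.gate, L.gate_scope⟩ ≠ L.on L.gate)
    (h2 : x ⟨Sum.inl L.gate, L.gate_scope⟩ ≠ L.off L.gate) :
    (L.refresh x).1 ⟨L.gate, L.gate_scope⟩ = x ⟨Sum.inl L.gate, L.gate_scope⟩ := by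
  unfold refresh
  rw [dif_pos ⟨h1, h2⟩]

variable [∀ i, Fintype (S i)] [∀ j, Fintype (A j)]

theorem card_context_mul_card_arm_le :
    Nat.card L.Context * Nat.card (Arm A Z i) ≤ scopeCard S A (Z i) := by
  have : ∀ c, Finite (Component S A c) := by
    rintro (c | c)
    · exact inferInstanceAs (Finite (S c))
    · exact inferInstanceAs (Finite (A c))
  rw [← Nat.card_prod]
  exact Nat.card_le_card_of_injective _ L.scopeOf_injective

/-- A scope value is recovered from its refreshed context, its arm and a marker in `Fin 3` telling
whether the gate was on, off or already fresh. The `3` is the price of reserving two gate values for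
the memory. -/
theorem scopeCard_le :
    scopeCard S A (Z i) ≤ Nat.card L.Context * Nat.card (Arm A Z i) * 3 := by
  classical
  have h3 : Nat.card (Fin 3) = 3 := by simp
  have := Nat.card_le_card_of_injective
    (fun x : ScopeSpace S A (Z i) => ((L.refresh x,
      (fun j : {j // Sum.inr j ∈ Z i} => x ⟨Sum.inr j.1, j.2⟩ : Arm A Z i)),
      (if x ⟨Sum.inl L.gate, L.gate_scope⟩ = L.on L.gate then (1 : Fin 3)
        else if x ⟨Sum.inl L.gate, L.gate_scope⟩ = L.off L.gate then 2 else 0))) ?_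
  · rwa [Nat.card_prod, Nat.card_prod, h3] at this
  intro x y hxy
  simp only [Prod.mk.injEq] at hxy
  obtain ⟨⟨hr, ha⟩, hf⟩ := hxy
  refine scopeSpace_ext (fun j h => ?_) fun j h => congrFun ha ⟨j, h⟩
  by_cases hj : j = L.gate
  · subst hj
    by_cases x1 : x ⟨Sum.inl L.gate, L.gate_scope⟩ = L.on L.gate <;>
    by_cases y1 : y ⟨Sum.inl L.gate, L.gate_scope⟩ = L.on L.gate
    · exact x1.trans y1.symm
    · rw [if_pos x1, if_neg y1] at hf
      split_ifs at hf <;> simp at hf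
    · rw [if_neg x1, if_pos y1] at hf
      split_ifs at hf <;> simp at hf
    rw [if_neg x1, if_neg y1] at hf
    by_cases x2 : x ⟨Sum.inl L.gate, L.gate_scope⟩ = L.off L.gate <;>
    by_cases y2 : y ⟨Sum.inl L.gate, L.gate_scope⟩ = L.off L.gate
    · exact x2.trans y2.symm
    · rw [if_pos x2, if_neg y2] at hf
      simp at hf
    · rw [if_neg x2, if_pos y2] at hf
      simp at hf
    rw [← L.refresh_apply_gate x x1 x2, hr, L.refresh_apply_gate y y1 y2]
  · rw [← L.refresh_apply_of_ne x ⟨j, h⟩ hj, hr, L.refresh_apply_of_ne y ⟨j, h⟩ hj]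

end Relay

end Cardinality

/-- The lower bound for one component with a loop and an action component in its scope. -/
theorem exists_fmdp_le_expectedRegret {m p : ℕ} {S : Fin m → Type u} {A : Fin p → Type u}
    [∀ i, Fintype (S i)] [∀ j, Fintype (A j)] [∀ j, Nonempty (A j)]
    {Z : Fin m → Finset (Fin m ⊕ Fin p)} {H K : ℕ} (hS : ∀ i, 3 ≤ Fintype.card (S i))
    {i : Fin m} (hi : HasLoop Z i) (hA : ∃ j, Sum.inr j ∈ Z i ∧ 2 ≤ Fintype.card (A j))
    (hH : 2 ≤ H) (hK : scopeCard S A (Z i) ≤ K) {Ω : Type v} [MeasurableSpace Ω] (μ : Measure Ω)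
    [IsProbabilityMeasure μ] (alg : Algorithm Ω (∀ i, S i) (∀ j, A j) H K) :
    ∃ (M : FMDP S A Z) (s₁ : Fin K → ∀ i, S i),
      1 / 512 * √((H : ℝ) * (scopeCard S A (Z i) : ℝ) * ((K : ℝ) * (H : ℝ))) ≤
        expectedRegret M.transition M.R s₁ μ alg := by
  classical
  obtain ⟨L⟩ := nonempty_relay S hS hi
  have : Fintype L.Context := Fintype.ofFinite _
  have hcard1 := L.card_context_mul_card_arm_le (A := A)
  have hcard2 := L.scopeCard_le (A := A)
  rw [Nat.card_eq_fintype_card, Nat.card_eq_fintype_card] at hcard1 hcard2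
  have hB : 2 ≤ Fintype.card (Relay.Arm A Z i) := by
    obtain ⟨j, hj, hj2⟩ := hA
    have : Nontrivial (A j) := Fintype.one_lt_card_iff_nontrivial.1 hj2
    exact Fintype.one_lt_card_iff_nontrivial.2
      (Pi.nontrivial_at (⟨j, hj⟩ : {j : Fin p // Sum.inr j ∈ Z i}))
  have : Nonempty L.Context := by
    have : ∀ j, Nonempty (S j) := fun j => Fintype.card_pos_iff.1 (by have := hS j; omega)
    exact ⟨L.refresh fun c => pair (S := S) (A := A) (fun _ => Classical.arbitrary _)
      (fun _ => Classical.arbitrary _) c.1⟩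
  have hC : 0 < Fintype.card L.Context := Fintype.card_pos
  set N := Fintype.card (Relay.Arm A Z i) with hN
  set M := Fintype.card L.Context with hM
  have hMN : M * N ≤ K := hcard1.trans hK
  obtain ⟨n, rfl⟩ : ∃ n, H = n + 1 := ⟨H - 1, by omega⟩
  obtain ⟨ctx, hctx⟩ := exists_balanced (C := L.Context) (K := K)
    ((Nat.le_mul_of_pos_right M (by omega)).trans hMN)
  rw [← hM] at hctx
  have hM' : (0 : ℝ) < M := by exact_mod_cast hC
  have hN' : (0 : ℝ) < N := by
    have : 0 < N := by omega
    exact_mod_cast this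
  have hMN' : (M : ℝ) * N ≤ K := by exact_mod_cast hMN
  have hK' : (0 : ℝ) < K := (mul_pos hM' hN').trans_le hMN'
  -- The bias will be `r / (32 * K)`, the scale at which the good arm is barely detectable. As `M *
  -- N ≤ K`, one has `r ≤ K`, and the bias is at most `1 / 32`.
  set r : ℝ := √(M * N * K) with hr
  have hr0 : 0 ≤ r := Real.sqrt_nonneg _
  have hr2 : r ^ 2 = M * N * K := Real.sq_sqrt (by positivity)
  have hrK : r ≤ K := by
    rw [hr, Real.sqrt_le_left hK'.le]
    nlinarith
  have hg : r / (32 * K) ∈ Set.Icc (0 : ℝ) (1 / 4) := by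
    refine ⟨by positivity, ?_⟩
    rw [div_le_iff₀ (by positivity)]
    linarith
  obtain ⟨θ, hθ⟩ := (L.hardFamily A hg).exists_le_expectedRegret hB ctx (by
    intro z
    -- Each context is visited at most `2 * K / M` times, and `M * N / (2 * K)` times this is
    -- exactly `N`: the constant 32 is chosen for that.
    have e : 512 * (r / (32 * K)) ^ 2 = M * N / (2 * K) := by
      rw [div_pow, hr2]
      field_simp
      norm_num
    change 512 * (r / (32 * K)) ^ 2 * _ ≤ _
    rw [e]
    refine (mul_le_mul_of_nonneg_left (hctx z) (by positivity)).trans (le_of_eq ?_)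
    field_simp
    rfl) μ alg
  refine ⟨L.fmdp hg fun c => some (θ c), fun k => L.start (ctx k), le_trans ?_ hθ⟩
  have h1 : (n : ℝ) * (r / (32 * K)) * (K / 4) = n * r / 128 := by
    field_simp
    ring
  change _ ≤ (n : ℝ) * (r / (32 * K)) * (K / 4)
  rw [h1]
  have hX : (scopeCard S A (Z i) : ℝ) ≤ M * N * 3 := by exact_mod_cast hcard2
  have hn : (1 : ℝ) ≤ n := by
    have : 1 ≤ n := by omega
    exact_mod_cast this
  -- Here `n + 1 ≤ 2 * n` uses `H ≥ 2`. With the factor 3 from the scope, the radicand is at most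
  -- `12 * n ^ 2 * r ^ 2 ≤ (4 * n * r) ^ 2`; since the regret is at least `n * r / 128`, the
  -- constant is `1 / (4 * 128) = 1 / 512`.
  have h2 : √(((n + 1 : ℕ) : ℝ) * (scopeCard S A (Z i) : ℝ) * ((K : ℝ) * ((n + 1 : ℕ) : ℝ))) ≤
      4 * n * r := by
    rw [Real.sqrt_le_left (by positivity), mul_pow, hr2]
    push_cast
    have h3 : ((n : ℝ) + 1) ^ 2 ≤ 4 * n ^ 2 := by nlinarith
    calc _ = ((n : ℝ) + 1) ^ 2 * ((scopeCard S A (Z i) : ℝ) * K) := by ring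
      _ ≤ 4 * n ^ 2 * (M * N * 3 * K) :=
        mul_le_mul h3 (mul_le_mul_of_nonneg_right hX hK'.le) (by positivity) (by positivity)
      _ ≤ _ := by
        have : (0 : ℝ) ≤ n ^ 2 * (M * N * K) := by positivity
        linarith
  linarith

end EpisodicRL

end

theorem theorem5 :
    ∃ c : ℝ, 0 < c ∧
      ∀ (m p : ℕ) (S : Fin m → Type u) (A : Fin p → Type u)
        [∀ i, Fintype (S i)] [∀ j, Fintype (A j)] [∀ j, Nonempty (A j)]
        (Z : Fin m → Finset (Fin m ⊕ Fin p)) (H K : ℕ),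
        (∀ i, 3 ≤ Fintype.card (S i)) →
        (∀ i ∈ EpisodicRL.loopActionSet Z, ∃ j, Sum.inr j ∈ Z i ∧ 2 ≤ Fintype.card (A j)) →
        2 ≤ H →
        (∀ i ∈ EpisodicRL.loopActionSet Z, EpisodicRL.scopeCard S A (Z i) ≤ K) →
        ∀ (Ω : Type v) [MeasurableSpace Ω] (μ : MeasureTheory.Measure Ω)
          [MeasureTheory.IsProbabilityMeasure μ]
          (alg : EpisodicRL.Algorithm Ω (∀ i, S i) (∀ j, A j) H K),
          ∃ (M : EpisodicRL.FMDP S A Z) (s₁ : Fin K → ∀ i, S i),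
            ∀ i ∈ EpisodicRL.loopActionSet Z,
              c * √((H : ℝ) * (EpisodicRL.scopeCard S A (Z i) : ℝ) * ((K : ℝ) * (H : ℝ))) ≤
                EpisodicRL.expectedRegret M.transition M.R s₁ μ alg := by
  classical
  refine ⟨1 / 512, by norm_num, ?_⟩
  intro m p S A _ _ _ Z H K hS hA hH hK Ω _ μ _ alg
  rcases (EpisodicRL.loopActionSet Z).eq_empty_or_nonempty with hI | hI
  · have hne : ∀ j, Nonempty (S j) := fun j =>
      Fintype.card_pos_iff.1 (lt_of_lt_of_le (by norm_num) (hS j))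
    refine ⟨⟨fun j _ => ⟨Pi.single (Classical.arbitrary _) 1, single_mem_stdSimplex ℝ _⟩,
      fun _ _ => 0, fun _ _ => by simp⟩, fun _ _ => Classical.arbitrary _, fun i hi => ?_⟩
    rw [hI] at hi
    exact hi.elim
  -- One instance has to serve all components at once; the one built for the largest scope does.
  · obtain ⟨i, hi, hmax⟩ := Set.exists_max_image _
      (fun i => EpisodicRL.scopeCard S A (Z i)) (Set.toFinite _) hI
    obtain ⟨M, s₁, h⟩ := EpisodicRL.exists_fmdp_le_expectedRegret hS hi.1 (hA i hi) hH (hK i hi)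
      μ alg
    refine ⟨M, s₁, fun j hj => le_trans ?_ h⟩
    have : (EpisodicRL.scopeCard S A (Z j) : ℝ) ≤ EpisodicRL.scopeCard S A (Z i) :=
      Nat.cast_le.2 (hmax j hj)
    gcongr
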